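/- Let $0<a<1$ and put $\sigma=\sqrt{a/(1-a)}$. Let $X$ be a real random variable with a probability density $f$, let $Z\sim\mathcal N(0,1)$ be independent of $X$, and let $Y=X+Z$. Let $\psi(y)=\mathsf{med}(X\mid Y=y)$ be a median, for every $y\in\mathbb R$, of the conditional law of $X$ given $Y=y$, i.e. of the law with density $x\mapsto f(x)e^{-(x-y)^2/2}\big/\int f(u)e^{-(u-y)^2/2}\,du$. Let $\psi^{-1}(x)=\sup\{y:\psi(y)\le x\}$ (the inverse function when $\psi$ is invertible). For $n\ge 0$ let $$H_n(x)=\frac1{K_n}\,e^{\frac{x^2}{2\sigma^2}}\,\frac{d^n}{dx^n}e^{-\frac{x^2}{\sigma^2}},\qquad K_n=\frac{\pi^{1/4}2^{n/2}\sqrt{n!}}{\sigma^{\,n-1/2}},$$ be the $L^2(\mathbb R)$-normalized Hermite functions, and let $c_n=\langle f,H_n\rangle=\int f H_n\,dx$ be the Hermite coefficients of $f$. Let $M,B,S$ be real numbers and $\varepsilon\ge 0$, and assume: 1. $f(x)\le M$ for all $x$, and $f\in L^2(\mathbb R)$; 2. $\displaystyle\int_{-\infty}^\infty \exp\Big(\tfrac{1-a}{2}y^2-\min_{x\in[ay-\sqrt{2a\varepsilon},\,ay+\sqrt{2a\varepsilon}]}\tfrac{(x-y)^2}{2}\Big)\,|ay-\psi(y)|\,dy\le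 B$; 3. there are real numbers $b_i$ ($i\in\mathbb Z$) with $\sum_{i\in\mathbb Z} b_i\le\varepsilon$ (a convergent sum) and $|\psi^{-1}(x)-x/a|\le b_i$ for all $x\in[i,i+1)$, $i\in\mathbb Z$; 4. $\displaystyle\sum_{n=0}^\infty |c_n|\,n^{1/4}\le S<\infty$. Then there is a constant $C$ depending only on $a,M,B,S$ (not on $\varepsilon$, $f$, $\psi$) such that $$\|f-c_0H_0\|_2^2\le C\varepsilon .$$ Consequently $f$ is $L^2$-close to the density $p$ of $\mathcal N\big(0,\tfrac{a}{1-a}\big)$: for every $\delta>0$ there is $\varepsilon_0>0$ depending only on $a,M,B,S,\delta$ such that, if in addition $\varepsilon\le\varepsilon_0$, then $\|f-p\|_2\le\delta$. -/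

import Mathlib

open MeasureTheory ProbabilityTheory

noncomputable section

namespace L1Stability

/-- `f` is a (pointwise nonnegative, Borel) probability density on the real line. -/
structure IsProbDensity (f : ℝ → ℝ) : Prop where
  measurable : Measurable f
  nonneg : ∀ x, 0 ≤ f x
  lintegral_eq_one : ∫⁻ x, ENNReal.ofReal (f x) = 1

/-- The density at `y` of `Y = X + Z`, where `X` has density `f` and `Z ∼ N(0,1)` is independent
of `X`. Recall that `gaussianPDFReal x 1 y = (2π)^(-1/2) exp(-(y-x)^2/2)`. -/
def outputDensity (f : ℝ → ℝ) (y : ℝ) : ℝ :=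
  ∫ x, f x * gaussianPDFReal x 1 y

/-- The conditional law of `X` given `Y = y` for `Y = X + Z`, where `X` has density `f` and
`Z ∼ N(0,1)` is independent of `X`: the law with density
`f_{X|Y}(x|y) = f(x) f_{Y|X}(y|x) / f_Y(y)`. -/
def condLaw (f : ℝ → ℝ) (y : ℝ) : Measure ℝ :=
  volume.withDensity fun x =>
    ENNReal.ofReal (f x * gaussianPDFReal x 1 y / outputDensity f y)

theorem IsProbDensity.integrable {f : ℝ → ℝ} (hf : IsProbDensity f) : Integrable f := by
  refine ⟨hf.measurable.aestronglyMeasurable, ?_⟩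
  rw [hasFiniteIntegral_iff_ofReal (Filter.Eventually.of_forall hf.nonneg), hf.lintegral_eq_one]
  exact ENNReal.one_lt_top

theorem gaussianPDFReal_one_le (x y : ℝ) : gaussianPDFReal x 1 y ≤ (√(2 * Real.pi))⁻¹ := by
  rw [gaussianPDFReal_def]
  simp only [NNReal.coe_one, mul_one]
  refine mul_le_of_le_one_right (by positivity) (Real.exp_le_one_iff.2 ?_)
  exact div_nonpos_of_nonpos_of_nonneg (neg_nonpos.2 (sq_nonneg _)) (by norm_num)

theorem measurable_kernel : Measurable fun p : ℝ × ℝ => gaussianPDFReal p.1 1 p.2 :=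
  measurable_uncurry_gaussianPDFReal.comp
    (measurable_fst.prodMk (measurable_const.prodMk measurable_snd))

theorem IsProbDensity.integrable_mul {f : ℝ → ℝ} (hf : IsProbDensity f) (y : ℝ) :
    Integrable fun x => f x * gaussianPDFReal x 1 y := by
  refine hf.integrable.mul_bdd (c := (√(2 * Real.pi))⁻¹) ?_ ?_
  · exact (measurable_kernel.comp (measurable_id.prodMk measurable_const)).aestronglyMeasurable
  · refine Filter.Eventually.of_forall fun x => ?_
    rw [Real.norm_of_nonneg (gaussianPDFReal_nonneg _ _ _)]
    exact gaussianPDFReal_one_le x y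

theorem IsProbDensity.outputDensity_pos {f : ℝ → ℝ} (hf : IsProbDensity f) (y : ℝ) :
    0 < outputDensity f y := by
  unfold outputDensity
  rw [integral_pos_iff_support_of_nonneg
    (fun x => mul_nonneg (hf.nonneg x) (gaussianPDFReal_nonneg _ _ _)) (hf.integrable_mul y)]
  have h1 : (Function.support fun x => f x * gaussianPDFReal x 1 y) = Function.support f := by
    ext x
    simp [(gaussianPDFReal_pos x 1 y one_ne_zero).ne']
  rw [h1, ← integral_pos_iff_support_of_nonneg hf.nonneg hf.integrable,
    integral_eq_lintegral_of_nonneg_ae (Filter.Eventually.of_forall hf.nonneg)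
      hf.measurable.aestronglyMeasurable, hf.lintegral_eq_one]
  norm_num

theorem IsProbDensity.measurable_joint {f : ℝ → ℝ} (hf : IsProbDensity f) :
    Measurable fun p : ℝ × ℝ => f p.1 * gaussianPDFReal p.1 1 p.2 :=
  (hf.measurable.comp measurable_fst).mul measurable_kernel

theorem IsProbDensity.measurable_outputDensity {f : ℝ → ℝ} (hf : IsProbDensity f) :
    Measurable (outputDensity f) :=
  (StronglyMeasurable.integral_prod_left (hf.measurable_joint.stronglyMeasurable)).measurable

theorem IsProbDensity.condLaw_mul {f : ℝ → ℝ} (hf : IsProbDensity f) (y : ℝ) {A : Set ℝ}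
    (hA : MeasurableSet A) :
    condLaw f y A * ENNReal.ofReal (outputDensity f y)
      = ∫⁻ x in A, ENNReal.ofReal (f x * gaussianPDFReal x 1 y) := by
  have hm : Measurable fun x => f x * gaussianPDFReal x 1 y :=
    hf.measurable_joint.comp (measurable_id.prodMk measurable_const)
  rw [condLaw, withDensity_apply _ hA, ← lintegral_mul_const _ (hm.div_const _).ennreal_ofReal]
  refine lintegral_congr fun x => ?_
  rw [← ENNReal.ofReal_mul (div_nonneg (mul_nonneg (hf.nonneg x) (gaussianPDFReal_nonneg _ _ _))
    (hf.outputDensity_pos y).le), div_mul_cancel₀ _ (hf.outputDensity_pos y).ne']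

/-- `condLaw f y` is a probability measure for every `y`. -/
theorem IsProbDensity.isProbabilityMeasure_condLaw {f : ℝ → ℝ} (hf : IsProbDensity f) (y : ℝ) :
    IsProbabilityMeasure (condLaw f y) := by
  refine ⟨?_⟩
  have h := hf.condLaw_mul y MeasurableSet.univ
  rw [Measure.restrict_univ, ← ofReal_integral_eq_lintegral_ofReal (hf.integrable_mul y)
    (Filter.Eventually.of_forall fun x =>
      mul_nonneg (hf.nonneg x) (gaussianPDFReal_nonneg _ _ _))] at h
  have hp : ENNReal.ofReal (outputDensity f y) ≠ 0 := by
    simpa using hf.outputDensity_pos y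
  exact (ENNReal.mul_eq_right hp ENNReal.ofReal_ne_top).1 h

theorem lintegral_joint {f : ℝ → ℝ} (hf : IsProbDensity f) {Ω : Type*} [MeasurableSpace Ω]
    {P : Measure Ω} [IsProbabilityMeasure P] {X Z : Ω → ℝ} (hX : Measurable X)
    (hZ : Measurable Z) (hXZ : IndepFun X Z P)
    (hXlaw : P.map X = volume.withDensity fun x => ENNReal.ofReal (f x))
    (hZlaw : P.map Z = gaussianReal 0 1) {h : ℝ × ℝ → ENNReal} (hh : Measurable h) :
    ∫⁻ ω, h (X ω, X ω + Z ω) ∂P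
      = ∫⁻ x, ∫⁻ y, h (x, y) * ENNReal.ofReal (f x * gaussianPDFReal x 1 y) := by
  have hs : Measurable fun p : ℝ × ℝ => h (p.1, p.1 + p.2) :=
    hh.comp (measurable_fst.prodMk (measurable_fst.add measurable_snd))
  have e1 : ∫⁻ ω, h (X ω, X ω + Z ω) ∂P
      = ∫⁻ p, h (p.1, p.1 + p.2) ∂(P.map fun ω => (X ω, Z ω)) :=
    (lintegral_map hs (hX.prodMk hZ)).symm
  rw [e1, (indepFun_iff_map_prod_eq_prod_map_map hX.aemeasurable hZ.aemeasurable).1 hXZ, hZlaw,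
    lintegral_prod _ hs.aemeasurable, hXlaw,
    lintegral_withDensity_eq_lintegral_mul _ hf.measurable.ennreal_ofReal
      hs.lintegral_prod_right']
  refine lintegral_congr fun x => ?_
  have hx : Measurable fun z => h (x, x + z) := hs.comp (measurable_const.prodMk measurable_id)
  have hxy : Measurable fun y => h (x, y) := hh.comp (measurable_const.prodMk measurable_id)
  rw [Pi.mul_apply, gaussianReal_of_var_ne_zero _ one_ne_zero,
    lintegral_withDensity_eq_lintegral_mul _ (measurable_gaussianPDF 0 1) hx,
    ← lintegral_const_mul _ ((measurable_gaussianPDF 0 1).mul hx),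
    ← lintegral_sub_right_eq_self _ x]
  refine lintegral_congr fun y => ?_
  have hg : gaussianPDFReal 0 1 (y - x) = gaussianPDFReal x 1 y := by
    rw [gaussianPDFReal_sub, zero_add]
  rw [Pi.mul_apply, gaussianPDF, hg, add_sub_cancel, ENNReal.ofReal_mul (hf.nonneg x)]
  ring

/-- `condLaw f` is a regular conditional law of `X` given `Y = X + Z`, for all random variables
`X` with density `f` and `Z ∼ N(0,1)` independent of `X`. -/
theorem condLaw_isConditionalLaw {f : ℝ → ℝ} (hf : IsProbDensity f) {Ω : Type*}
    [MeasurableSpace Ω] {P : Measure Ω} [IsProbabilityMeasure P] {X Z : Ω → ℝ}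
    (hX : Measurable X) (hZ : Measurable Z) (hXZ : IndepFun X Z P)
    (hXlaw : P.map X = volume.withDensity fun x => ENNReal.ofReal (f x))
    (hZlaw : P.map Z = gaussianReal 0 1) {A B : Set ℝ} (hA : MeasurableSet A)
    (hB : MeasurableSet B) :
    P {ω | X ω ∈ A ∧ X ω + Z ω ∈ B}
      = ∫⁻ y in B, condLaw f y A ∂(P.map fun ω => X ω + Z ω) := by
  have hmj := hf.measurable_joint.ennreal_ofReal
  have hcm : Measurable fun y => condLaw f y A := by
    have : (fun y => condLaw f y A) = fun y => ∫⁻ x in A,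
        ENNReal.ofReal (f x * gaussianPDFReal x 1 y / outputDensity f y) := by
      ext y
      rw [condLaw, withDensity_apply _ hA]
    rw [this]
    have hq : Measurable fun p : ℝ × ℝ =>
        ENNReal.ofReal (f p.1 * gaussianPDFReal p.1 1 p.2 / outputDensity f p.2) :=
      (hf.measurable_joint.div (hf.measurable_outputDensity.comp measurable_snd)).ennreal_ofReal
    exact hq.lintegral_prod_left'
  have hL : P {ω | X ω ∈ A ∧ X ω + Z ω ∈ B}
      = ∫⁻ ω, (A ×ˢ B).indicator 1 (X ω, X ω + Z ω) ∂P := by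
    have hm : MeasurableSet {ω | X ω ∈ A ∧ X ω + Z ω ∈ B} := (hX hA).inter ((hX.add hZ) hB)
    rw [← lintegral_indicator_one hm]
    rfl
  have hR : ∫⁻ y in B, condLaw f y A ∂(P.map fun ω => X ω + Z ω)
      = ∫⁻ ω, B.indicator (fun y => condLaw f y A) (X ω + Z ω) ∂P := by
    have hY : Measurable fun ω => X ω + Z ω := hX.add hZ
    rw [← lintegral_indicator hB, lintegral_map (hcm.indicator hB) hY]
  have hBm : Measurable fun p : ℝ × ℝ => B.indicator (fun y => condLaw f y A) p.2 :=
    (hcm.indicator hB).comp measurable_snd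
  have hABm : Measurable ((A ×ˢ B).indicator (1 : ℝ × ℝ → ENNReal)) :=
    measurable_one.indicator (hA.prod hB)
  rw [hL, hR, lintegral_joint hf hX hZ hXZ hXlaw hZlaw hABm,
    lintegral_joint hf hX hZ hXZ hXlaw hZlaw hBm]
  refine (lintegral_lintegral_swap (hABm.mul hmj).aemeasurable).trans
    (Eq.trans ?_ (lintegral_lintegral_swap (hBm.mul hmj).aemeasurable).symm)
  refine lintegral_congr fun y => ?_
  have hmy : Measurable fun x => ENNReal.ofReal (f x * gaussianPDFReal x 1 y) :=
    hmj.comp (measurable_id.prodMk measurable_const)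
  dsimp only
  rw [lintegral_const_mul _ hmy, ← ofReal_integral_eq_lintegral_ofReal (hf.integrable_mul y)
    (Filter.Eventually.of_forall fun x =>
      mul_nonneg (hf.nonneg x) (gaussianPDFReal_nonneg _ _ _))]
  by_cases hy : y ∈ B
  · rw [Set.indicator_of_mem hy]
    refine Eq.trans ?_ (hf.condLaw_mul y hA).symm
    rw [← lintegral_indicator hA]
    refine lintegral_congr fun x => ?_
    by_cases hx : x ∈ A <;> simp [Set.indicator, hx, hy]
  · simp [Set.indicator, hy]

/-- `m` is a median of `μ`. -/
def IsMedian (μ : Measure ℝ) (m : ℝ) : Prop :=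
  1 / 2 ≤ μ (Set.Iic m) ∧ 1 / 2 ≤ μ (Set.Ici m)

/-- `ψ(y) = med(X | Y = y)` for every `y`, for `Y = X + Z` as above. -/
def IsCondMedian (f ψ : ℝ → ℝ) : Prop :=
  ∀ y, IsMedian (condLaw f y) (ψ y)

/-- The (generalized) inverse `ψ⁻¹(x) = sup {y | ψ(y) ≤ x}` of a nondecreasing function; it is the
inverse function if `ψ` is an increasing bijection. If the set is empty or unbounded for some `x`,
then the value `0` is taken along a whole half-line, where `|ψ⁻¹(x) - x/a|` is unbounded. -/
def genInv (ψ : ℝ → ℝ) (x : ℝ) : ℝ :=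
  sSup {y | ψ y ≤ x}

/-- `min_{x ∈ [ay - √(2aε), ay + √(2aε)]} (x - y)^2 / 2`. -/
def minExponent (a ε y : ℝ) : ℝ :=
  sInf ((fun x : ℝ => (x - y) ^ 2 / 2) ''
    Set.Icc (a * y - √(2 * a * ε)) (a * y + √(2 * a * ε)))

/-- The assumptions on the prior density `f` and its conditional median `ψ`. -/
structure NearLinearMedian (a M B ε : ℝ) (f ψ : ℝ → ℝ) : Prop where
  density : IsProbDensity f
  bounded : ∀ x, f x ≤ M
  median : IsCondMedian f ψ
  weighted_integral :
    ∫⁻ y, ENNReal.ofReal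
      (Real.exp ((1 - a) / 2 * y ^ 2 - minExponent a ε y) * |a * y - ψ y|) ≤ ENNReal.ofReal B
  inverse_close : ∃ b : ℤ → ℝ, Summable b ∧ ∑' i, b i ≤ ε ∧
    ∀ x, |genInv ψ x - x / a| ≤ b ⌊x⌋

/-- `σ = √(a / (1 - a))`. -/
def sigma (a : ℝ) : ℝ := √(a / (1 - a))

/-- The normalization `K_n = π^(1/4) 2^(n/2) √(n!) / σ^(n - 1/2)`. -/
def hermiteNorm (a : ℝ) (n : ℕ) : ℝ :=
  Real.pi ^ (1 / 4 : ℝ) * 2 ^ ((n : ℝ) / 2) * √(n.factorial : ℝ)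
    / sigma a ^ ((n : ℝ) - 1 / 2)

/-- The Hermite function `H_n(x) = K_n⁻¹ exp(x²/(2σ²)) dⁿ/dxⁿ exp(-x²/σ²)`. -/
def hermiteFun (a : ℝ) (n : ℕ) (x : ℝ) : ℝ :=
  1 / hermiteNorm a n * Real.exp (x ^ 2 / (2 * sigma a ^ 2))
    * iteratedDeriv n (fun t : ℝ => Real.exp (-t ^ 2 / sigma a ^ 2)) x

/-- The Hermite coefficient `c_n = ⟨f, H_n⟩`. -/
def hermiteCoeff (a : ℝ) (f : ℝ → ℝ) (n : ℕ) : ℝ :=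
  ∫ x, f x * hermiteFun a n x

end L1Stability

end

/-!
Let `σ² = a / (1 - a)` and let `g = f exp (x² / (2σ²))` be the tilted density (`tilt`); it is
constant exactly if `f` is the density of `N(0, σ²)`. Completing the square, the conditional law
of `X` given `Y = y` has a density proportional to `g(x) exp (-(x - a y)² / (2a))`. Hence `a y` is
a conditional median for all `y` if and only if the *sign potential* `F(t) = ∫ g(x) sign (x - t)
exp (-(x - t)² / (2a)) dx` (`signPot`) vanishes. In general, `F(a y)` is bounded by twice the
integral of `g(x) exp (-(x - a y)² / (2a))` over the interval between `a y` and `ψ y`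
(`abs_signPot_tilt_le`).

*The sign potential is small.* The weighted integral hypothesis and `f ≤ M` give `‖F‖₁ = O(1)`. As
`F` is the derivative of the convolution `E` of `g` with the positive tail kernel `∫_{|u|}^∞ exp
(-r² / (2a)) dr` (`tailPot`, `tailPot_sub`), `E` is bounded, and so are the masses of `g` on unit
intervals. A point `x` is between `a y` and `ψ y` only if `|y - x / a| ≤ b ⌊x⌋`, so that
integrating over `y` first gives `‖F‖₁ ≤ C ∑ bᵢ ≤ C ε` (`exists_integral_abs_signPot_le`).

*Deconvolution.* The tail kernel is a mixture of centred Gaussians, hence so is its Fourier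
transform (`tailHat`), which is at least `c / (1 + ξ²)` (`exists_le_tailHat`). Dividing a Gaussian
by it, every Gaussian is the convolution of the tail kernel with a Schwartz function
(`exists_deconvolution`). The Hermite coefficients `cₙ` of `f` are, up to normalization, the
pairings of `g` with the derivatives of `exp (-x² / σ²)`, that is, pairings of `E` with
derivatives of a Schwartz function. For `n ≥ 1`, one derivative is moved to `E`; Gaussian moments
and the duplication formula for the Gamma function then give `|cₙ| ≤ C n^(1/4) ‖F‖₁`
(`exists_abs_hermiteCoeff_le`). By Parseval's identity (`hasSum_hermiteCoeff_sq`), `‖f - c₀ H₀‖² =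
∑_{n ≥ 1} cₙ² ≤ C ‖F‖₁ ∑ |cₙ| n^(1/4) ≤ C S ε`.

*The zeroth coefficient.* Up to `O(‖F‖₁)`, `E` is constant, so all the Gaussian averages of `g`
are those of one constant, whatever the width of the Gaussian. Two of these averages are the mass
`1` of `f` and a multiple of `c₀`; this determines `c₀` up to `O(ε)`
(`exists_abs_hermiteCoeff_zero_sub_le`).
-/

noncomputable section

namespace L1Stability

open Real Set Filter Topology
open scoped FourierTransform SchwartzMap ContDiff Polynomial

/-! ### The Gaussian tail kernel -/

/-- The (unnormalized) two-sided Gaussian tail `u ↦ ∫_{|u|}^∞ exp (-α r²) dr`. -/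
def gaussTail (α u : ℝ) : ℝ := ∫ r in Ioi |u|, exp (-α * r ^ 2)

variable {α : ℝ}

lemma gaussTail_eq_sub (hα : 0 < α) (u : ℝ) :
    gaussTail α u = √(π / α) / 2 - ∫ r in (0 : ℝ)..|u|, exp (-α * r ^ 2) := by
  have hi := integrable_exp_neg_mul_sq hα
  rw [← integral_gaussian_Ioi, ← intervalIntegral.integral_Ioi_sub_Ioi hi.integrableOn
    (abs_nonneg u)]
  simp [gaussTail]

lemma continuous_gaussTail (hα : 0 < α) : Continuous (gaussTail α) := by
  have hc : Continuous fun r : ℝ => exp (-α * r ^ 2) := by fun_prop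
  have h := (intervalIntegral.continuous_primitive (μ := volume)
    (fun a b => hc.intervalIntegrable a b) 0).comp
    continuous_abs
  exact (continuous_const.sub h).congr fun u => (gaussTail_eq_sub hα u).symm

lemma gaussTail_nonneg (α u : ℝ) : 0 ≤ gaussTail α u :=
  setIntegral_nonneg measurableSet_Ioi fun _ _ => (exp_pos _).le

lemma gaussTail_neg (α u : ℝ) : gaussTail α (-u) = gaussTail α u := by
  simp [gaussTail]

lemma gaussTail_pos (hα : 0 < α) (u : ℝ) : 0 < gaussTail α u := by
  rw [gaussTail, setIntegral_pos_iff_support_of_nonneg_ae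
    (Eventually.of_forall fun _ => (exp_pos _).le) (integrable_exp_neg_mul_sq hα).integrableOn]
  have : (Function.support fun r : ℝ => exp (-α * r ^ 2)) = univ := by
    ext r; simp [(exp_pos _).ne']
  rw [this, univ_inter, volume_Ioi]
  exact ENNReal.zero_lt_top

lemma gaussTail_anti (hα : 0 < α) {u v : ℝ} (h : |u| ≤ |v|) : gaussTail α v ≤ gaussTail α u :=
  setIntegral_mono_set (integrable_exp_neg_mul_sq hα).integrableOn
    (Eventually.of_forall fun _ => (exp_pos _).le) (Ioi_subset_Ioi h).eventuallyLE

/-- The Mills-type bound, from `(|u| + v)² ≥ u² + v²`. -/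
lemma gaussTail_le (hα : 0 < α) (u : ℝ) :
    gaussTail α u ≤ √(π / α) / 2 * exp (-α * u ^ 2) := by
  have hi := integrable_exp_neg_mul_sq hα
  have h1 : gaussTail α u = ∫ v in Ioi (0 : ℝ), exp (-α * (v + |u|) ^ 2) := by
    rw [gaussTail, ← integral_indicator measurableSet_Ioi, ← integral_indicator measurableSet_Ioi,
      ← integral_add_right_eq_self _ |u|]
    congr 1 with v
    simp [indicator]
  rw [h1, mul_comm, ← integral_gaussian_Ioi, ← integral_const_mul]
  refine setIntegral_mono_on (hi.comp_add_right |u|).integrableOn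
    (hi.const_mul _).integrableOn measurableSet_Ioi fun v hv => ?_
  rw [← exp_add]
  refine exp_le_exp.2 ?_
  have : 0 ≤ v * |u| := mul_nonneg (le_of_lt hv) (abs_nonneg u)
  have h2 : |u| ^ 2 = u ^ 2 := sq_abs u
  nlinarith

lemma measurable_coe_sign : Measurable fun x : ℝ => (SignType.sign x : ℝ) := by
  have : (fun x : ℝ => (SignType.sign x : ℝ)) = fun x => if 0 < x then 1 else if x < 0 then -1
      else 0 := by
    ext x
    rw [sign_apply]
    split_ifs <;> simp
  rw [this]
  exact Measurable.ite measurableSet_Ioi measurable_const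
    (Measurable.ite measurableSet_Iio measurable_const measurable_const)

lemma abs_coe_sign_le_one (x : ℝ) : |(SignType.sign x : ℝ)| ≤ 1 := by
  rcases SignType.sign x with _ | _ | _ <;> simp

/-- The tail kernel `u ↦ gaussTail α (x - u)` is a primitive of the odd kernel
`u ↦ sign (x - u) exp (-α (x - u)²)`. -/
lemma intervalIntegral_sign_mul_exp (hα : 0 < α) (x s t : ℝ) :
    ∫ r in s..t, (SignType.sign (x - r) : ℝ) * exp (-α * (x - r) ^ 2)
      = gaussTail α (x - t) - gaussTail α (x - s) := by
  have hc : Continuous fun r : ℝ => exp (-α * r ^ 2) := by fun_prop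
  have hsm : Measurable fun r : ℝ => (SignType.sign (x - r) : ℝ) :=
    measurable_coe_sign.comp (measurable_const.sub measurable_id)
  refine integral_eq_of_hasDerivAt_off_countable (fun r => gaussTail α (x - r)) _
    (countable_singleton x) ((continuous_gaussTail hα).comp (by fun_prop)).continuousOn ?_ ?_
  · rintro r ⟨-, hr⟩
    have hr' : x - r ≠ 0 := sub_ne_zero.2 fun h => hr (by simp [h])
    have h1 : HasDerivAt (fun r => |x - r|) (SignType.sign (x - r) * -1) r :=
      (hasDerivAt_abs hr').comp r ((hasDerivAt_id r).const_sub x)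
    have h2 := (intervalIntegral.integral_hasDerivAt_right
      (hc.intervalIntegrable 0 |x - r|) hc.aestronglyMeasurable.stronglyMeasurableAtFilter
      hc.continuousAt).comp r h1
    have h3 := (h2.const_sub (√(π / α) / 2))
    refine (h3.congr_of_eventuallyEq
      (Eventually.of_forall fun r => gaussTail_eq_sub hα (x - r))).congr_deriv ?_
    simp only [sq_abs]
    ring
  · have h : Integrable (fun r : ℝ => exp (-α * (x - r) ^ 2)) := by
      simpa using (integrable_exp_neg_mul_sq hα).comp_sub_left x
    refine (h.bdd_mul (c := 1) hsm.aestronglyMeasurable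
      (Eventually.of_forall fun r => ?_)).intervalIntegrable
    exact abs_coe_sign_le_one _

lemma integral_Ioi_mul_exp_neg_mul_sq {β : ℝ} (hβ : 0 < β) (u : ℝ) :
    ∫ r in Ioi u, r * exp (-β * r ^ 2) = exp (-β * u ^ 2) / (2 * β) := by
  have hd : ∀ r ∈ Ici u, HasDerivAt (fun r : ℝ => -(exp (-β * r ^ 2) / (2 * β)))
      (r * exp (-β * r ^ 2)) r := fun r _ => by
    have := ((((hasDerivAt_pow 2 r).const_mul (-β)).exp).div_const (2 * β)).neg
    refine this.congr_deriv ?_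
    field_simp
    norm_num
    ring
  have ht : Tendsto (fun r : ℝ => -(exp (-β * r ^ 2) / (2 * β))) atTop (𝓝 0) := by
    have h1 : Tendsto (fun r : ℝ => β * r ^ 2) atTop atTop :=
      (tendsto_pow_atTop two_ne_zero).const_mul_atTop hβ
    have h2 := ((tendsto_exp_neg_atTop_nhds_zero.comp h1).div_const (2 * β)).neg
    simpa [Function.comp_def] using h2
  rw [integral_Ioi_of_hasDerivAt_of_tendsto' hd (integrable_mul_exp_neg_mul_sq hβ).integrableOn ht]
  ring

lemma integral_Ioi_exp_neg_mul_mul_sq {r : ℝ} (hr : 0 < r) :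
    ∫ w in Ioi (0 : ℝ), r * exp (-α * (r * w) ^ 2) = √(π / α) / 2 := by
  have h := integral_comp_mul_left_Ioi (fun s : ℝ => exp (-α * s ^ 2)) 0 hr
  rw [mul_zero, integral_gaussian_Ioi] at h
  rw [integral_const_mul, h, smul_eq_mul, mul_inv_cancel_left₀ hr.ne']

/-- The joint density `r exp (-α r² (1 + w²))` is integrable on `r > c ≥ 0`, `w > 0`. -/
lemma integrable_prod_mixture (hα : 0 < α) {c : ℝ} (hc : 0 ≤ c) :
    Integrable (fun p : ℝ × ℝ => p.1 * exp (-(α * (1 + p.2 ^ 2)) * p.1 ^ 2))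
      ((volume.restrict (Ioi c)).prod (volume.restrict (Ioi 0))) := by
  have hcont : Continuous fun p : ℝ × ℝ => p.1 * exp (-(α * (1 + p.2 ^ 2)) * p.1 ^ 2) := by
    fun_prop
  have key : ∀ r w : ℝ, r * exp (-(α * (1 + w ^ 2)) * r ^ 2)
      = exp (-α * r ^ 2) * (r * exp (-α * (r * w) ^ 2)) := fun r w => by
    rw [mul_left_comm, ← exp_add]; ring_nf
  rw [integrable_prod_iff hcont.aestronglyMeasurable]
  constructor
  · filter_upwards [ae_restrict_mem measurableSet_Ioi] with r hr
    have hr0 : 0 < r := hc.trans_lt hr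
    simp_rw [key, mul_pow, ← mul_assoc (-α)]
    refine ((Integrable.const_mul ?_ r).const_mul _).integrableOn
    have : 0 < α * r ^ 2 := by positivity
    simpa using integrable_exp_neg_mul_sq this
  · refine Integrable.congr (f := fun r => exp (-α * r ^ 2) * (√(π / α) / 2)) ?_ ?_
    · exact ((integrable_exp_neg_mul_sq hα).mul_const _).integrableOn
    · filter_upwards [ae_restrict_mem measurableSet_Ioi] with r hr
      have hr0 : 0 < r := hc.trans_lt hr
      rw [← integral_Ioi_exp_neg_mul_mul_sq hr0, ← integral_const_mul]
      refine setIntegral_congr_fun measurableSet_Ioi fun w _ => ?_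
      rw [norm_of_nonneg (by positivity), key]

/-- The Gaussian tail is a mixture of centred Gaussians. -/
lemma gaussTail_mul_eq_integral (hα : 0 < α) (u : ℝ) :
    gaussTail α u * (√(π / α) / 2)
      = ∫ w in Ioi (0 : ℝ), exp (-(α * (1 + w ^ 2)) * u ^ 2) / (2 * (α * (1 + w ^ 2))) := by
  have h1 : gaussTail α u * (√(π / α) / 2)
      = ∫ r in Ioi |u|, ∫ w in Ioi (0 : ℝ), r * exp (-(α * (1 + w ^ 2)) * r ^ 2) := by
    rw [gaussTail, ← integral_mul_const]
    refine setIntegral_congr_fun measurableSet_Ioi fun r hr => ?_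
    have hr0 : 0 < r := (abs_nonneg u).trans_lt hr
    rw [← integral_Ioi_exp_neg_mul_mul_sq (α := α) hr0, ← integral_const_mul]
    congr 1 with w
    rw [mul_left_comm, ← exp_add]; ring_nf
  rw [h1, integral_integral_swap (integrable_prod_mixture hα (abs_nonneg u))]
  refine setIntegral_congr_fun measurableSet_Ioi fun w _ => ?_
  rw [integral_Ioi_mul_exp_neg_mul_sq (by positivity), sq_abs]

lemma integrable_pow_mul_gaussTail (hα : 0 < α) (n : ℕ) :
    Integrable fun u : ℝ => |u| ^ n * gaussTail α u := by
  have h : Integrable fun u : ℝ => √(π / α) / 2 * (|u| ^ n * exp (-α * u ^ 2)) := by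
    refine Integrable.const_mul ?_ _
    have h2 := (integrable_rpow_mul_exp_neg_mul_sq hα (s := n)
      (by linarith [n.cast_nonneg (α := ℝ)])).abs
    refine h2.congr (Eventually.of_forall fun u => ?_)
    simp [abs_mul, abs_pow]
  refine h.mono' ((by fun_prop : Continuous fun u : ℝ => |u| ^ n).mul
    (continuous_gaussTail hα)).aestronglyMeasurable (Eventually.of_forall fun u => ?_)
  rw [norm_of_nonneg (mul_nonneg (by positivity) (gaussTail_nonneg _ _)), mul_left_comm]
  exact mul_le_mul_of_nonneg_left (gaussTail_le hα u) (by positivity)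

lemma integrable_gaussTail (hα : 0 < α) : Integrable (gaussTail α) := by
  simpa using integrable_pow_mul_gaussTail hα 0

/-! ### The Fourier transform of the tail kernel -/

lemma fourier_gaussian_real {β : ℝ} (hβ : 0 < β) (ξ : ℝ) :
    ∫ u : ℝ, Complex.exp (↑(-2 * π * u * ξ) * Complex.I) * (exp (-β * u ^ 2) : ℝ)
      = ((√(π / β) * exp (-(π ^ 2 / β) * ξ ^ 2) : ℝ) : ℂ) := by
  have h := fourierIntegral_gaussian (b := (β : ℂ)) (by simpa using hβ) (-2 * π * ξ : ℝ)
  have e1 : ((π : ℂ) / β) ^ (1 / 2 : ℂ) = ((√(π / β) : ℝ) : ℂ) := by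
    rw [sqrt_eq_rpow, Complex.ofReal_cpow (by positivity)]
    simp
  rw [e1] at h
  rw [Complex.ofReal_mul]
  convert h using 2
  · ext u
    push_cast
    congr 2
    ring
  · push_cast
    congr 1
    field_simp
    ring

/-- The Fourier transform of the tail kernel as a mixture of Gaussians. -/
lemma fourier_gaussTail_mul (hα : 0 < α) (ξ : ℝ) :
    𝓕 (fun u => (gaussTail α u : ℂ)) ξ * ((√(π / α) / 2 : ℝ) : ℂ)
      = ((∫ w in Ioi (0 : ℝ), √(π / (α * (1 + w ^ 2))) * exp (-(π ^ 2 / (α * (1 + w ^ 2))) * ξ ^ 2)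
          / (2 * (α * (1 + w ^ 2))) : ℝ) : ℂ) := by
  have hβ : ∀ w : ℝ, 0 < α * (1 + w ^ 2) := fun w => by positivity
  have hmeas : AEStronglyMeasurable (fun p : ℝ × ℝ =>
      Complex.exp (↑(-2 * π * p.1 * ξ) * Complex.I) *
        ((exp (-(α * (1 + p.2 ^ 2)) * p.1 ^ 2) / (2 * (α * (1 + p.2 ^ 2))) : ℝ) : ℂ))
      (volume.prod (volume.restrict (Ioi 0))) := by
    refine Measurable.aestronglyMeasurable ?_
    fun_prop
  have hnorm : ∀ u w : ℝ, ‖Complex.exp (↑(-2 * π * u * ξ) * Complex.I) *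
        ((exp (-(α * (1 + w ^ 2)) * u ^ 2) / (2 * (α * (1 + w ^ 2))) : ℝ) : ℂ)‖
        = exp (-(α * (1 + w ^ 2)) * u ^ 2) / (2 * (α * (1 + w ^ 2))) := fun u w => by
    rw [norm_mul, Complex.norm_exp_ofReal_mul_I, one_mul, Complex.norm_real, norm_of_nonneg]
    have := hβ w
    positivity
  have hint : Integrable (fun p : ℝ × ℝ =>
      Complex.exp (↑(-2 * π * p.1 * ξ) * Complex.I) *
        ((exp (-(α * (1 + p.2 ^ 2)) * p.1 ^ 2) / (2 * (α * (1 + p.2 ^ 2))) : ℝ) : ℂ))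
      (volume.prod (volume.restrict (Ioi 0))) := by
    rw [integrable_prod_iff' hmeas]
    constructor
    · refine Eventually.of_forall fun w => ?_
      refine Integrable.mono' ((integrable_exp_neg_mul_sq (hβ w)).div_const
        (2 * (α * (1 + w ^ 2)))) (by fun_prop) (Eventually.of_forall fun u => (hnorm u w).le)
    · simp_rw [hnorm, integral_div, integral_gaussian]
      have hb : Integrable (fun w : ℝ => √(π / α) / (2 * α) * (1 + w ^ 2)⁻¹) :=
        integrable_inv_one_add_sq.const_mul _
      refine (hb.mono' (Measurable.aestronglyMeasurable (by fun_prop))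
        (Eventually.of_forall fun w => ?_)).integrableOn
      have h1 := hβ w
      rw [norm_of_nonneg (by positivity)]
      have : √(π / (α * (1 + w ^ 2))) ≤ √(π / α) := by
        refine sqrt_le_sqrt (div_le_div_of_nonneg_left pi_pos.le hα ?_)
        nlinarith [sq_nonneg w]
      rw [show √(π / α) / (2 * α) * (1 + w ^ 2)⁻¹ = √(π / α) / (2 * (α * (1 + w ^ 2))) by
        field_simp]
      gcongr
  rw [fourier_real_eq_integral_exp_smul, ← integral_mul_const, ← integral_complex_ofReal]
  have e : ∀ u : ℝ, Complex.exp (↑(-2 * π * u * ξ) * Complex.I) • (gaussTail α u : ℂ) *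
      ((√(π / α) / 2 : ℝ) : ℂ) = ∫ w in Ioi (0 : ℝ),
        Complex.exp (↑(-2 * π * u * ξ) * Complex.I) *
        ((exp (-(α * (1 + w ^ 2)) * u ^ 2) / (2 * (α * (1 + w ^ 2))) : ℝ) : ℂ) := fun u => by
    rw [smul_eq_mul, mul_assoc, ← Complex.ofReal_mul, gaussTail_mul_eq_integral hα,
      ← integral_complex_ofReal, integral_const_mul]
  simp_rw [e]
  rw [integral_integral_swap hint]
  congr 1 with w
  have := fourier_gaussian_real (hβ w) ξ
  rw [Complex.ofReal_div, ← this, ← integral_div]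
  congr 1 with u
  push_cast
  ring

/-- The Fourier transform of the (even) tail kernel, as a real function. -/
def tailHat (α ξ : ℝ) : ℝ := (𝓕 (fun u => (gaussTail α u : ℂ)) ξ).re

lemma tailHat_mul (hα : 0 < α) (ξ : ℝ) :
    tailHat α ξ * (√(π / α) / 2) = ∫ w in Ioi (0 : ℝ),
      √(π / (α * (1 + w ^ 2))) * exp (-(π ^ 2 / (α * (1 + w ^ 2))) * ξ ^ 2)
          / (2 * (α * (1 + w ^ 2))) := by
  have h := congrArg Complex.re (fourier_gaussTail_mul hα ξ)
  rwa [Complex.re_mul_ofReal, Complex.ofReal_re] at h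

lemma ofReal_tailHat (hα : 0 < α) (ξ : ℝ) :
    (tailHat α ξ : ℂ) = 𝓕 (fun u => (gaussTail α u : ℂ)) ξ := by
  have h0 : ((√(π / α) / 2 : ℝ) : ℂ) ≠ 0 := by
    rw [Complex.ofReal_ne_zero]; positivity
  rw [← mul_left_inj' h0, fourier_gaussTail_mul hα, ← tailHat_mul hα, Complex.ofReal_mul]

/-- The Fourier transform of the tail kernel decays no faster than quadratically: in its
representation as a Gaussian mixture, the mixture components `w ∈ (√(1 + ξ²), 2√(1 + ξ²))` alone
have a contribution of this size. -/
lemma exists_le_tailHat (hα : 0 < α) :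
    ∃ c : ℝ, 0 < c ∧ ∀ ξ : ℝ, c / (1 + ξ ^ 2) ≤ tailHat α ξ := by
  have hβ : ∀ w : ℝ, 0 < α * (1 + w ^ 2) := fun w => by positivity
  set K := √(π / α) / 2 with hK
  have hKpos : 0 < K := by positivity
  set c1 := √(π / α) * exp (-(π ^ 2 / α)) / (2 * α) with hc1
  have hc1pos : 0 < c1 := by positivity
  have hint : ∀ ξ : ℝ, IntegrableOn (fun w : ℝ => √(π / (α * (1 + w ^ 2))) *
      exp (-(π ^ 2 / (α * (1 + w ^ 2))) * ξ ^ 2) / (2 * (α * (1 + w ^ 2)))) (Ioi 0) := fun ξ => by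
    have hb : Integrable (fun w : ℝ => √(π / α) / (2 * α) * (1 + w ^ 2)⁻¹) :=
      integrable_inv_one_add_sq.const_mul _
    refine (hb.mono' (Measurable.aestronglyMeasurable (by fun_prop))
      (Eventually.of_forall fun w => ?_)).integrableOn
    have h1 := hβ w
    rw [norm_of_nonneg (by positivity)]
    have h2 : √(π / (α * (1 + w ^ 2))) ≤ √(π / α) := by
      refine sqrt_le_sqrt (div_le_div_of_nonneg_left pi_pos.le hα ?_)
      nlinarith [sq_nonneg w]
    have h3 : exp (-(π ^ 2 / (α * (1 + w ^ 2))) * ξ ^ 2) ≤ 1 := by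
      rw [exp_le_one_iff, neg_mul, neg_nonpos]; positivity
    rw [show √(π / α) / (2 * α) * (1 + w ^ 2)⁻¹ = √(π / α) * 1 / (2 * (α * (1 + w ^ 2))) by
      field_simp]
    gcongr
  refine ⟨c1 / (15 * K), by positivity, fun ξ => ?_⟩
  rw [← mul_le_mul_iff_left₀ hKpos, tailHat_mul hα]
  set ρ := √(1 + ξ ^ 2) with hρ
  have hρ2 : ρ ^ 2 = 1 + ξ ^ 2 := sq_sqrt (by positivity)
  have hρ1 : 0 < ρ := by positivity
  have hρge : 1 ≤ ρ ^ 2 := by rw [hρ2]; nlinarith [sq_nonneg ξ]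
  -- Here `1 + w² ≤ 5 ρ²`, so that `√(1 + w²) ≤ 3 ρ`.
  have hlow : ∀ w ∈ Ioc ρ (2 * ρ), c1 / (15 * ρ ^ 3) ≤ √(π / (α * (1 + w ^ 2))) *
      exp (-(π ^ 2 / (α * (1 + w ^ 2))) * ξ ^ 2) / (2 * (α * (1 + w ^ 2))) := by
    rintro w ⟨hw1, hw2⟩
    have hw0 : 0 < w := hρ1.trans hw1
    have hwu : 1 + w ^ 2 ≤ 5 * ρ ^ 2 := by nlinarith
    have hwl : ξ ^ 2 ≤ 1 + w ^ 2 := by nlinarith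
    have h1 : √(π / α) / (3 * ρ) ≤ √(π / (α * (1 + w ^ 2))) := by
      rw [show π / (α * (1 + w ^ 2)) = π / α / (1 + w ^ 2) by field_simp,
        sqrt_div (show 0 ≤ π / α by positivity)]
      refine div_le_div_of_nonneg_left (sqrt_nonneg _) (by positivity) ?_
      rw [sqrt_le_left (by positivity)]
      nlinarith
    have h2 : exp (-(π ^ 2 / α)) ≤ exp (-(π ^ 2 / (α * (1 + w ^ 2))) * ξ ^ 2) := by
      refine exp_le_exp.2 ?_
      rw [neg_mul, neg_le_neg_iff, div_mul_eq_mul_div, div_le_div_iff₀ (hβ w) hα]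
      have : 0 ≤ π ^ 2 * α := by positivity
      nlinarith
    have h3 : 2 * (α * (1 + w ^ 2)) ≤ 2 * (α * (5 * ρ ^ 2)) := by gcongr
    calc c1 / (15 * ρ ^ 3)
        = √(π / α) / (3 * ρ) * exp (-(π ^ 2 / α)) / (2 * (α * (5 * ρ ^ 2))) := by
          rw [hc1]; field_simp; ring
      _ ≤ _ := by
          have := hβ w
          gcongr
  calc c1 / (15 * K) / (1 + ξ ^ 2) * K = ∫ _ in Ioc ρ (2 * ρ), c1 / (15 * ρ ^ 3) := by
        rw [setIntegral_const, measureReal_def, volume_Ioc, ENNReal.toReal_ofReal (by linarith),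
          ← hρ2, smul_eq_mul]
        field_simp
        ring
    _ ≤ ∫ w in Ioc ρ (2 * ρ), √(π / (α * (1 + w ^ 2))) *
          exp (-(π ^ 2 / (α * (1 + w ^ 2))) * ξ ^ 2) / (2 * (α * (1 + w ^ 2))) :=
        setIntegral_mono_on (integrableOn_const (by simp)) ((hint ξ).mono_set
          fun w hw => hρ1.trans hw.1) measurableSet_Ioc hlow
    _ ≤ _ := setIntegral_mono_set (hint ξ)
        (Eventually.of_forall fun w => by have := hβ w; positivity)
        (Eventually.of_forall fun w hw => hρ1.trans hw.1)

lemma tailHat_pos (hα : 0 < α) (ξ : ℝ) : 0 < tailHat α ξ := by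
  obtain ⟨c, hc, h⟩ := exists_le_tailHat hα
  exact lt_of_lt_of_le (by positivity) (h ξ)

lemma norm_fourier_le (f : ℝ → ℂ) (ξ : ℝ) : ‖𝓕 f ξ‖ ≤ ∫ x, ‖f x‖ := by
  rw [fourier_real_eq_integral_exp_smul]
  refine (norm_integral_le_integral_norm _).trans (le_of_eq ?_)
  congr 1 with x
  rw [norm_smul, Complex.norm_exp_ofReal_mul_I, one_mul]

lemma hasTemperateGrowth_tailHat (hα : 0 < α) : (tailHat α).HasTemperateGrowth := by
  have hi : ∀ n : ℕ, Integrable fun x : ℝ => x ^ n • (gaussTail α x : ℂ) := fun n => by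
    refine Integrable.mono' (integrable_pow_mul_gaussTail hα n)
      (Continuous.aestronglyMeasurable ?_) (Eventually.of_forall fun u => ?_)
    · have := continuous_gaussTail hα
      fun_prop
    · rw [norm_smul, norm_pow, Complex.norm_real, norm_of_nonneg (gaussTail_nonneg α u),
        norm_eq_abs]
  have hF : (𝓕 (fun u => (gaussTail α u : ℂ))).HasTemperateGrowth := by
    constructor
    · refine contDiff_fourier (N := ⊤) fun n _ => ?_
      simpa [norm_smul] using (hi n).norm
    · intro n
      refine ⟨0, ∫ x : ℝ, ‖(-2 * ↑π * Complex.I * ↑x) ^ n • (gaussTail α x : ℂ)‖, fun x => ?_⟩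
      rw [norm_iteratedFDeriv_eq_norm_iteratedDeriv,
        iteratedDeriv_fourier (N := ⊤) (fun n _ => hi n) le_top, pow_zero, mul_one]
      exact norm_fourier_le _ _
  exact (Complex.reCLM.hasTemperateGrowth).comp hF

/-- A function of temperate growth that decays at most quadratically has a reciprocal of temperate
growth. -/
lemma hasTemperateGrowth_inv {h : ℝ → ℝ} (hh : h.HasTemperateGrowth) {c : ℝ} (hc : 0 < c)
    (hle : ∀ ξ, c / (1 + ξ ^ 2) ≤ h ξ) : (fun ξ => (h ξ)⁻¹).HasTemperateGrowth := by
  have hp : (fun ξ : ℝ => 1 + ξ ^ 2).HasTemperateGrowth := by fun_prop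
  have hH : (fun ξ : ℝ => (1 + ξ ^ 2) * h ξ).HasTemperateGrowth := hp.mul hh
  -- `ξ ↦ (1 + ξ²) h ξ` is bounded below, so that only derivatives of `x⁻¹` on `(c / 2, ∞)` enter.
  have hinv : (Inv.inv ∘ fun ξ : ℝ => (1 + ξ ^ 2) * h ξ).HasTemperateGrowth := by
    refine hH.comp' (t := Ioi (c / 2)) ?_ isOpen_Ioi.uniqueDiffOn ?_ ?_
    · rintro _ ⟨ξ, rfl⟩
      have := hle ξ
      rw [div_le_iff₀ (by positivity)] at this
      simp only [mem_Ioi]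
      nlinarith
    · exact contDiffOn_id.inv fun x hx => ((half_pos hc).trans hx).ne'
    · intro N
      refine ⟨0, ∑ n ∈ Finset.range (N + 1), n.factorial * (c / 2)⁻¹ ^ (n + 1), by positivity,
        fun n hn x hx => ?_⟩
      rw [norm_iteratedFDerivWithin_eq_norm_iteratedDerivWithin,
        iteratedDerivWithin_of_isOpen isOpen_Ioi hx, iteratedDeriv_eq_iterate, iter_deriv_inv,
        pow_zero, mul_one]
      have hx0 : 0 < c / 2 := by positivity
      have hx1 : 0 < x := hx0.trans hx
      have e : x ^ (-1 - (n : ℤ)) = x⁻¹ ^ (n + 1) := by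
        rw [inv_pow, ← zpow_natCast, ← zpow_neg]; congr 1; push_cast; ring
      rw [e, norm_mul, norm_mul, norm_pow, norm_neg, norm_one, one_pow, one_mul,
        norm_of_nonneg (by positivity), norm_of_nonneg (by positivity)]
      refine le_trans ?_ (Finset.single_le_sum
        (f := fun n : ℕ => (n.factorial : ℝ) * (c / 2)⁻¹ ^ (n + 1))
        (fun n _ => by positivity) (Finset.mem_range.2 (Nat.lt_succ_of_le hn)))
      have : x⁻¹ ≤ (c / 2)⁻¹ := inv_anti₀ hx0 (le_of_lt hx)
      gcongr
  have e : (fun ξ => (h ξ)⁻¹)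
      = (fun ξ : ℝ => 1 + ξ ^ 2) * (Inv.inv ∘ fun ξ : ℝ => (1 + ξ ^ 2) * h ξ) := by
    funext ξ
    simp only [Function.comp, Pi.mul_apply]
    rw [mul_inv, mul_inv_cancel_left₀ (by positivity)]
  rw [e]
  exact hp.mul hinv

/-! ### Gaussians as Schwartz functions -/

lemma iteratedDeriv_ofReal_comp {f : ℝ → ℝ} (hf : ContDiff ℝ ∞ f) (m : ℕ) :
    iteratedDeriv m (fun x => (f x : ℂ)) = fun x => ((iteratedDeriv m f x : ℝ) : ℂ) := by
  induction m with
  | zero => simp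
  | succ m ih =>
    rw [iteratedDeriv_succ, ih]
    ext x
    have hd : DifferentiableAt ℝ (iteratedDeriv m f) x :=
      (hf.differentiable_iteratedDeriv m (by exact_mod_cast ENat.natCast_lt_top m)) x
    rw [iteratedDeriv_succ]
    exact hd.hasDerivAt.ofReal_comp.deriv

/-- The polynomials in the derivatives of a Gaussian, `dⁿ/dxⁿ exp (-β x²) = Pₙ(x) exp (-β x²)`; up to
scaling and sign these are the Hermite polynomials. -/
def gaussPoly (β : ℝ) : ℕ → ℝ[X]
  | 0 => 1
  | n + 1 => Polynomial.derivative (gaussPoly β n)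
      + Polynomial.C (-2 * β) * Polynomial.X * gaussPoly β n

lemma hasDerivAt_eval_mul_gaussian (β : ℝ) (P : ℝ[X]) (x : ℝ) :
    HasDerivAt (fun x => P.eval x * exp (-β * x ^ 2))
      ((Polynomial.derivative P + Polynomial.C (-2 * β) * Polynomial.X * P).eval x
        * exp (-β * x ^ 2)) x := by
  refine ((P.hasDerivAt x).mul (((hasDerivAt_pow 2 x).const_mul (-β)).exp)).congr_deriv ?_
  simp
  ring

lemma iteratedDeriv_gaussian (β : ℝ) (n : ℕ) :
    iteratedDeriv n (fun x : ℝ => exp (-β * x ^ 2))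
      = fun x => (gaussPoly β n).eval x * exp (-β * x ^ 2) := by
  induction n with
  | zero => simp [gaussPoly]
  | succ n ih =>
    rw [iteratedDeriv_succ, ih]
    ext x
    exact (hasDerivAt_eval_mul_gaussian β _ x).deriv

lemma exists_pow_mul_exp_le {β : ℝ} (hβ : 0 < β) (m : ℕ) :
    ∃ C, ∀ x : ℝ, |x| ^ m * exp (-β * x ^ 2) ≤ C := by
  refine ⟨1 + m.factorial / β ^ m, fun x => ?_⟩
  have h1 : |x| ^ m ≤ 1 + (x ^ 2) ^ m := by
    rcases le_total |x| 1 with h | h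
    · have := pow_le_one₀ (n := m) (abs_nonneg x) h
      have : 0 ≤ (x ^ 2) ^ m := by positivity
      linarith
    · rw [← sq_abs x, ← pow_mul]
      have := pow_le_pow_right₀ h (show m ≤ 2 * m by omega)
      linarith
  have h2 : (x ^ 2) ^ m * exp (-β * x ^ 2) ≤ m.factorial / β ^ m := by
    have := pow_div_factorial_le_exp (β * x ^ 2) (by positivity) m
    rw [neg_mul, exp_neg, ← div_eq_mul_inv, div_le_div_iff₀ (exp_pos _) (by positivity)]
    rw [div_le_iff₀ (by positivity), mul_pow] at this
    linarith
  have h3 : exp (-β * x ^ 2) ≤ 1 := by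
    rw [exp_le_one_iff, neg_mul, neg_nonpos]; positivity
  nlinarith [mul_le_mul_of_nonneg_right h1 (exp_pos (-β * x ^ 2)).le]

lemma exists_eval_mul_exp_le {β : ℝ} (hβ : 0 < β) (P : ℝ[X]) :
    ∃ C, ∀ x : ℝ, |P.eval x| * exp (-β * x ^ 2) ≤ C := by
  induction P using Polynomial.induction_on' with
  | add p q hp hq =>
    obtain ⟨C, hC⟩ := hp
    obtain ⟨D, hD⟩ := hq
    refine ⟨C + D, fun x => ?_⟩
    rw [Polynomial.eval_add]
    refine (mul_le_mul_of_nonneg_right (abs_add_le _ _) (exp_pos _).le).trans ?_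
    rw [add_mul]
    exact add_le_add (hC x) (hD x)
  | monomial n r =>
    obtain ⟨C, hC⟩ := exists_pow_mul_exp_le hβ n
    refine ⟨|r| * C, fun x => ?_⟩
    rw [Polynomial.eval_monomial, abs_mul, abs_pow, mul_assoc]
    exact mul_le_mul_of_nonneg_left (hC x) (abs_nonneg r)

/-- The Gaussian `x ↦ exp (-β x²)`, `β > 0`, as a Schwartz function. -/
def gaussSchwartz (β : ℝ) (hβ : 0 < β) : 𝓢(ℝ, ℂ) where
  toFun x := (exp (-β * x ^ 2) : ℂ)
  smooth' := by
    have : ContDiff ℝ ∞ fun x : ℝ => exp (-β * x ^ 2) := by fun_prop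
    exact Complex.ofRealCLM.contDiff.comp this
  decay' k n := by
    obtain ⟨C, hC⟩ := exists_eval_mul_exp_le hβ (Polynomial.X ^ k * gaussPoly β n)
    refine ⟨C, fun x => ?_⟩
    have hsm : ContDiff ℝ ∞ fun x : ℝ => exp (-β * x ^ 2) := by fun_prop
    rw [norm_iteratedFDeriv_eq_norm_iteratedDeriv, iteratedDeriv_ofReal_comp hsm,
      iteratedDeriv_gaussian, Complex.norm_real, norm_mul, norm_eq_abs, norm_eq_abs,
      norm_of_nonneg (exp_pos _).le, ← mul_assoc, ← abs_pow, ← abs_mul]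
    simpa using hC x

@[simp] lemma gaussSchwartz_apply {β : ℝ} (hβ : 0 < β) (x : ℝ) :
    gaussSchwartz β hβ x = (exp (-β * x ^ 2) : ℂ) := rfl

/-! ### Deconvolution of Gaussians by the tail kernel -/

lemma fourier_gaussSchwartz {β : ℝ} (hβ : 0 < β) (x : ℝ) :
    𝓕 (fun ξ : ℝ => ((√(π / β) * exp (-(π ^ 2 / β) * ξ ^ 2) : ℝ) : ℂ)) x
      = (exp (-β * x ^ 2) : ℂ) := by
  have hβ' : 0 < π ^ 2 / β := by positivity
  have h := fourier_gaussian_real hβ' x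
  have e1 : √(π / β) * √(π / (π ^ 2 / β)) = 1 := by
    rw [← sqrt_mul (by positivity)]
    rw [show π / β * (π / (π ^ 2 / β)) = 1 by field_simp, sqrt_one]
  rw [fourier_real_eq_integral_exp_smul]
  simp_rw [smul_eq_mul, Complex.ofReal_mul (√(π / β)), mul_left_comm _ ((√(π / β) : ℝ) : ℂ)]
  rw [integral_const_mul, h, ← Complex.ofReal_mul, ← mul_assoc, e1, one_mul]
  congr 3
  field_simp

lemma fourier_gaussTail_comp_sub (hα : 0 < α) (x ξ : ℝ) :
    𝓕 (fun t => (gaussTail α (x - t) : ℂ)) ξ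
      = Complex.exp (↑(-2 * π * ξ * x) * Complex.I) * tailHat α ξ := by
  rw [ofReal_tailHat hα, fourier_real_eq_integral_exp_smul, fourier_real_eq_integral_exp_smul,
    ← integral_const_mul, ← integral_add_right_eq_self _ x]
  congr 1 with u
  rw [show x - (u + x) = -u by ring, gaussTail_neg, smul_eq_mul, smul_eq_mul, ← mul_assoc,
    ← Complex.exp_add]
  congr 2
  push_cast
  ring

/-- Self-adjointness of the Fourier transform on the real line. -/
lemma integral_fourier_mul_eq {f g : ℝ → ℂ} (hf : Integrable f) (hg : Integrable g) :
    ∫ ξ, 𝓕 f ξ * g ξ = ∫ x, f x * 𝓕 g x := by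
  simpa using! VectorFourier.integral_bilin_fourierIntegral_eq_flip (.mul ℂ ℂ) (L := innerₗ ℝ)
    continuous_fourierChar continuous_inner hf hg

/-- For every Gaussian `exp (-β x²)` there is a Schwartz function `q 0` (with derivatives `q m`)
whose convolution with the tail kernel is that Gaussian. It is obtained by dividing by `tailHat`
on the Fourier side, which also gives the bounds on the derivatives. -/
lemma exists_deconvolution (hα : 0 < α) {β : ℝ} (hβ : 0 < β) :
    ∃ q : ℕ → 𝓢(ℝ, ℂ), (∀ m x, HasDerivAt (q m) (q (m + 1) x) x) ∧
      (∀ m x, ∫ t, q m t * (gaussTail α (x - t) : ℂ)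
        = iteratedDeriv m (fun x : ℝ => (exp (-β * x ^ 2) : ℂ)) x) ∧
      (∀ m t, ‖q m t‖ ≤ ∫ ξ : ℝ, |2 * π * ξ| ^ m *
        (√(π / β) * exp (-(π ^ 2 / β) * ξ ^ 2) * (tailHat α ξ)⁻¹)) ∧
      ∫ t, q 0 t = ((√(π / β) * (tailHat α 0)⁻¹ : ℝ) : ℂ) := by
  obtain ⟨c, hc, hle⟩ := exists_le_tailHat hα
  have hβ' : 0 < π ^ 2 / β := by positivity
  have hg1 : (fun ξ : ℝ => (((tailHat α ξ)⁻¹ : ℝ) : ℂ)).HasTemperateGrowth :=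
    Complex.ofRealCLM.hasTemperateGrowth.comp
      (hasTemperateGrowth_inv (hasTemperateGrowth_tailHat hα) hc hle)
  have hg2 : ∀ m : ℕ, (fun ξ : ℝ => (-2 * π * Complex.I * (ξ : ℂ)) ^ m).HasTemperateGrowth :=
    fun m => ((Function.HasTemperateGrowth.const _).mul Complex.ofRealCLM.hasTemperateGrowth).pow m
  set G : 𝓢(ℝ, ℂ) := ((√(π / β) : ℝ) : ℂ) • gaussSchwartz (π ^ 2 / β) hβ' with hG
  have hGa : ∀ ξ, G ξ = ((√(π / β) * exp (-(π ^ 2 / β) * ξ ^ 2) : ℝ) : ℂ) := fun ξ => by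
    simp [hG]
  set Q : 𝓢(ℝ, ℂ) := SchwartzMap.smulLeftCLM ℂ (fun ξ : ℝ => (((tailHat α ξ)⁻¹ : ℝ) : ℂ)) G with hQ
  have hQa : ∀ ξ, Q ξ = (((tailHat α ξ)⁻¹ : ℝ) : ℂ) * G ξ := fun ξ =>
    SchwartzMap.smulLeftCLM_apply_apply hg1 G ξ
  set f : ℕ → 𝓢(ℝ, ℂ) := fun m =>
    SchwartzMap.smulLeftCLM ℂ (fun ξ : ℝ => (-2 * π * Complex.I * (ξ : ℂ)) ^ m) Q with hf
  have hfa : ∀ m ξ, f m ξ = (-2 * π * Complex.I * (ξ : ℂ)) ^ m * Q ξ := fun m ξ =>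
    SchwartzMap.smulLeftCLM_apply_apply (hg2 m) Q ξ
  refine ⟨fun m => 𝓕 (f m), fun m x => ?_, fun m x => ?_, fun m t => ?_, ?_⟩
  · have h1 : Integrable fun ξ : ℝ => ξ • f m ξ := by
      have := (f m).integrable_pow_mul volume 1
      refine this.mono' (by fun_prop) (Eventually.of_forall fun ξ => ?_)
      simp
    have h2 := hasDerivAt_fourier (f m).integrable h1 x
    rw [SchwartzMap.fourier_coe, SchwartzMap.fourier_coe]
    refine h2.congr_deriv (congrArg (fun F : ℝ → ℂ => 𝓕 F x) ?_)
    funext ξ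
    rw [hfa, hfa, pow_succ, smul_eq_mul]
    ring
  · have hti : Integrable (fun t => (gaussTail α (x - t) : ℂ)) :=
      ((integrable_gaussTail hα).comp_sub_left x).ofReal
    rw [SchwartzMap.fourier_coe, integral_fourier_mul_eq (f m).integrable hti]
    have hGi : ∀ n : ℕ, Integrable fun ξ : ℝ => ξ ^ n • G ξ := fun n => by
      have := G.integrable_pow_mul volume n
      refine this.mono' (by fun_prop) (Eventually.of_forall fun ξ => ?_)
      simp
    have e : (fun x : ℝ => (exp (-β * x ^ 2) : ℂ)) = 𝓕 (G : ℝ → ℂ) := by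
      ext x
      rw [← fourier_gaussSchwartz hβ x]
      exact congrArg (fun F : ℝ → ℂ => 𝓕 F x) (funext fun ξ => (hGa ξ).symm)
    rw [e, iteratedDeriv_fourier (N := ⊤) (fun n _ => hGi n) le_top,
      fourier_real_eq_integral_exp_smul]
    congr 1 with ξ
    rw [fourier_gaussTail_comp_sub hα, hfa, hQa, smul_eq_mul, smul_eq_mul]
    have h0 : (tailHat α ξ : ℂ) ≠ 0 := Complex.ofReal_ne_zero.2 (tailHat_pos hα ξ).ne'
    push_cast
    field_simp
  · rw [SchwartzMap.fourier_coe]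
    refine (norm_fourier_le _ _).trans (le_of_eq ?_)
    congr 1 with ξ
    have h0 := tailHat_pos hα ξ
    rw [hfa, hQa, hGa, norm_mul, norm_mul, Complex.norm_real, Complex.norm_real,
      norm_of_nonneg (by positivity), norm_of_nonneg (by positivity), norm_pow]
    have : ‖-2 * π * Complex.I * (ξ : ℂ)‖ = |2 * π * ξ| := by
      simp [abs_mul]
    rw [this]
    ring
  · have h1 : ∫ t, (𝓕 (f 0)) t = (𝓕⁻ (𝓕 (f 0))) 0 := by
      rw [SchwartzMap.fourierInv_coe, fourierInv_eq']
      simp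
    have h2 : (𝓕⁻ (𝓕 (f 0))) = f 0 := FourierTransform.fourierInv_fourier_eq (f 0)
    rw [h1, h2, hfa, hQa, hGa]
    simp [mul_comm]

/-! ### Potentials of a nonnegative function -/

/-- The convolution of `g` with the odd Gaussian kernel:
`t ↦ ∫ g x sign (x - t) exp (-α (x - t)²) dx`. -/
def signPot (α : ℝ) (g : ℝ → ℝ) (t : ℝ) : ℝ :=
  ∫ x, g x * ((SignType.sign (x - t) : ℝ) * exp (-α * (x - t) ^ 2))

/-- The convolution of `g` with the tail kernel. -/
def tailPot (α : ℝ) (g : ℝ → ℝ) (t : ℝ) : ℝ :=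
  ∫ x, g x * gaussTail α (x - t)

/-- `g` is nonnegative and its Gaussian averages are finite and grow at most like a Gaussian. -/
structure GaussAdmissible (α : ℝ) (g : ℝ → ℝ) : Prop where
  measurable : Measurable g
  nonneg : ∀ x, 0 ≤ g x
  integrable : ∀ t, Integrable fun x => g x * exp (-α * (x - t) ^ 2)
  exists_le : ∃ c : ℝ, ∀ t, ∫ x, g x * exp (-α * (x - t) ^ 2) ≤ exp (c * t ^ 2)

variable {g : ℝ → ℝ}

lemma GaussAdmissible.integrable_tail (hα : 0 < α) (hg : GaussAdmissible α g) (t : ℝ) :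
    Integrable fun x => g x * gaussTail α (x - t) := by
  have hc := continuous_gaussTail hα
  refine ((hg.integrable t).const_mul (√(π / α) / 2)).mono'
    (hg.measurable.mul (by fun_prop)).aestronglyMeasurable (Eventually.of_forall fun x => ?_)
  rw [norm_of_nonneg (mul_nonneg (hg.nonneg x) (gaussTail_nonneg _ _)), mul_left_comm]
  exact mul_le_mul_of_nonneg_left (gaussTail_le hα _) (hg.nonneg x)

lemma tailPot_nonneg (hg : GaussAdmissible α g) (t : ℝ) : 0 ≤ tailPot α g t :=
  integral_nonneg fun x => mul_nonneg (hg.nonneg x) (gaussTail_nonneg _ _)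

lemma measurable_signKernel (hg : GaussAdmissible α g) : Measurable fun p : ℝ × ℝ =>
    g p.2 * ((SignType.sign (p.2 - p.1) : ℝ) * exp (-α * (p.2 - p.1) ^ 2)) :=
  (hg.measurable.comp measurable_snd).mul
    ((measurable_coe_sign.comp (measurable_snd.sub measurable_fst)).mul (by fun_prop))

lemma norm_signKernel_le (hg : GaussAdmissible α g) (x t : ℝ) :
    ‖g x * ((SignType.sign (x - t) : ℝ) * exp (-α * (x - t) ^ 2))‖
      ≤ g x * exp (-α * (x - t) ^ 2) := by
  rw [norm_mul, norm_mul, norm_of_nonneg (hg.nonneg x), norm_of_nonneg (exp_pos _).le]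
  refine mul_le_mul_of_nonneg_left ?_ (hg.nonneg x)
  exact mul_le_of_le_one_left (exp_pos _).le (abs_coe_sign_le_one _)

lemma measurable_signPot (hg : GaussAdmissible α g) : Measurable (signPot α g) :=
  (StronglyMeasurable.integral_prod_right
    (measurable_signKernel hg).stronglyMeasurable).measurable

lemma measurable_tailPot (hα : 0 < α) (hg : GaussAdmissible α g) : Measurable (tailPot α g) := by
  have hc := (continuous_gaussTail hα).measurable
  have : Measurable fun p : ℝ × ℝ => g p.2 * gaussTail α (p.2 - p.1) :=
    (hg.measurable.comp measurable_snd).mul (hc.comp (measurable_snd.sub measurable_fst))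
  exact (StronglyMeasurable.integral_prod_right this.stronglyMeasurable).measurable

/-- The tail potential is a primitive of the sign potential. -/
lemma tailPot_sub (hα : 0 < α) (hg : GaussAdmissible α g) (s t : ℝ) :
    tailPot α g t - tailPot α g s = ∫ r in s..t, signPot α g r := by
  obtain ⟨c, hc⟩ := hg.exists_le
  have hint : Integrable (Function.uncurry fun r x =>
      g x * ((SignType.sign (x - r) : ℝ) * exp (-α * (x - r) ^ 2)))
      ((volume.restrict (uIoc s t)).prod volume) := by
    have hm := (measurable_signKernel hg).aestronglyMeasurable
      (μ := (volume.restrict (uIoc s t)).prod volume)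
    rw [Function.uncurry_def, integrable_prod_iff hm]
    constructor
    · refine Eventually.of_forall fun r => ?_
      exact (hg.integrable r).mono' ((measurable_signKernel hg).comp
        (measurable_const.prodMk measurable_id)).aestronglyMeasurable
        (Eventually.of_forall fun x => norm_signKernel_le hg x r)
    · have hce : Continuous fun r : ℝ => exp (c * r ^ 2) := by fun_prop
      refine ((hce.intervalIntegrable s t).def').mono' hm.norm.integral_prod_right' ?_
      refine Eventually.of_forall fun r => ?_
      rw [norm_of_nonneg (integral_nonneg fun _ => norm_nonneg _)]
      refine le_trans ?_ (hc r)
      refine integral_mono_of_nonneg (Eventually.of_forall fun _ => norm_nonneg _)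
        (hg.integrable r) (Eventually.of_forall fun x => norm_signKernel_le hg x r)
  unfold signPot
  rw [intervalIntegral_integral_swap hint, tailPot, tailPot,
    ← integral_sub (hg.integrable_tail hα t) (hg.integrable_tail hα s)]
  congr 1 with x
  rw [intervalIntegral.integral_const_mul, intervalIntegral_sign_mul_exp hα, mul_sub]

lemma abs_tailPot_sub_le (hα : 0 < α) (hg : GaussAdmissible α g)
    (hF : Integrable (signPot α g)) (s t : ℝ) :
    |tailPot α g t - tailPot α g s| ≤ ∫ r, |signPot α g r| := by
  rw [tailPot_sub hα hg, ← norm_eq_abs]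
  refine (intervalIntegral.norm_integral_le_integral_norm_uIoc).trans ?_
  exact setIntegral_le_integral hF.norm (Eventually.of_forall fun _ => norm_nonneg _)

lemma tailPot_le (hα : 0 < α) (hg : GaussAdmissible α g)
    (hF : Integrable (signPot α g)) (t : ℝ) :
    tailPot α g t ≤ tailPot α g 0 + ∫ r, |signPot α g r| := by
  have := (abs_le.1 (abs_tailPot_sub_le hα hg hF 0 t)).2
  linarith

/-- The mass of `g` on unit intervals is controlled by the tail potential. -/
lemma lintegral_Ico_le (hα : 0 < α) (hg : GaussAdmissible α g) (i : ℝ) :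
    ∫⁻ x in Ico i (i + 1), ENNReal.ofReal (g x)
      ≤ ENNReal.ofReal (tailPot α g i / gaussTail α 1) := by
  have h1 := gaussTail_pos hα 1
  have hc := continuous_gaussTail hα
  have hb : ∀ x ∈ Ico i (i + 1), ENNReal.ofReal (g x)
      ≤ ENNReal.ofReal (g x * gaussTail α (x - i) / gaussTail α 1) := fun x hx => by
    refine ENNReal.ofReal_le_ofReal ?_
    rw [le_div_iff₀ h1]
    refine mul_le_mul_of_nonneg_left (gaussTail_anti hα ?_) (hg.nonneg x)
    rw [abs_of_nonneg (by linarith [hx.1]), abs_one]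
    linarith [hx.2]
  calc ∫⁻ x in Ico i (i + 1), ENNReal.ofReal (g x)
      ≤ ∫⁻ x in Ico i (i + 1), ENNReal.ofReal (g x * gaussTail α (x - i) / gaussTail α 1) :=
        setLIntegral_mono' measurableSet_Ico hb
    _ ≤ ∫⁻ x, ENNReal.ofReal (g x * gaussTail α (x - i) / gaussTail α 1) :=
        setLIntegral_le_lintegral _ _
    _ = _ := by
        rw [← ofReal_integral_eq_lintegral_ofReal ((hg.integrable_tail hα i).div_const _)
          (Eventually.of_forall fun x => div_nonneg
            (mul_nonneg (hg.nonneg x) (gaussTail_nonneg _ _)) h1.le), integral_div]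
        rfl

/-- Fubini: pairing `g` with the convolution of `q` and the tail kernel is pairing the tail
potential of `g` with `q`. -/
lemma integral_mul_conv_eq (hα : 0 < α) (hg : GaussAdmissible α g)
    (hF : Integrable (signPot α g)) (q : 𝓢(ℝ, ℂ)) :
    ∫ x, (g x : ℂ) * ∫ t, q t * (gaussTail α (x - t) : ℂ) = ∫ t, (tailPot α g t : ℂ) * q t := by
  have hc := (continuous_gaussTail hα).measurable
  have hm : Measurable fun p : ℝ × ℝ => (g p.1 : ℂ) * (q p.2 * (gaussTail α (p.1 - p.2) : ℂ)) :=
    (Complex.measurable_ofReal.comp (hg.measurable.comp measurable_fst)).mul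
      ((q.continuous.measurable.comp measurable_snd).mul
        (Complex.measurable_ofReal.comp (hc.comp (measurable_fst.sub measurable_snd))))
  have hn : ∀ x t, ‖(g x : ℂ) * (q t * (gaussTail α (x - t) : ℂ))‖
      = g x * gaussTail α (x - t) * ‖q t‖ := fun x t => by
    rw [norm_mul, norm_mul, Complex.norm_real, Complex.norm_real, norm_of_nonneg (hg.nonneg x),
      norm_of_nonneg (gaussTail_nonneg _ _)]
    ring
  have hint : Integrable (Function.uncurry fun x t : ℝ =>
      (g x : ℂ) * (q t * (gaussTail α (x - t) : ℂ))) (volume.prod volume) := by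
    rw [Function.uncurry_def, integrable_prod_iff' hm.aestronglyMeasurable]
    constructor
    · refine Eventually.of_forall fun t => ?_
      refine ((hg.integrable_tail hα t).mul_const ‖q t‖).mono'
        (hm.comp (measurable_id.prodMk measurable_const)).aestronglyMeasurable
        (Eventually.of_forall fun x => (hn x t).le)
    · simp_rw [hn, integral_mul_const]
      refine (q.integrable.norm.const_mul (tailPot α g 0 + ∫ r, |signPot α g r|)).mono'
        ((measurable_tailPot hα hg).mul q.continuous.norm.measurable).aestronglyMeasurable
        (Eventually.of_forall fun t => ?_)
      change ‖tailPot α g t * ‖q t‖‖ ≤ _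
      rw [norm_mul, norm_norm, norm_of_nonneg (tailPot_nonneg hg t)]
      exact mul_le_mul_of_nonneg_right (tailPot_le hα hg hF t) (norm_nonneg _)
  simp_rw [← integral_const_mul]
  rw [integral_integral_swap hint]
  congr 1 with t
  rw [tailPot, ← integral_complex_ofReal, ← integral_mul_const]
  congr 1 with x
  push_cast
  ring

/-- The limit of the tail potential at `-∞`, provided that the sign potential is integrable. -/
def tailPotBot (α : ℝ) (g : ℝ → ℝ) : ℝ :=
  tailPot α g 0 - ∫ r in Iic 0, signPot α g r

lemma tailPot_eq_add (hα : 0 < α) (hg : GaussAdmissible α g)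
    (hF : Integrable (signPot α g)) (t : ℝ) :
    tailPot α g t = tailPotBot α g + ∫ r in Iic t, signPot α g r := by
  have h1 := tailPot_sub hα hg 0 t
  rw [← intervalIntegral.integral_Iic_sub_Iic hF.integrableOn hF.integrableOn] at h1
  rw [tailPotBot]
  linarith

/-- Up to the `L¹` norm of the sign potential, the tail potential is constant. -/
lemma norm_integral_tailPot_sub_le (hα : 0 < α) (hg : GaussAdmissible α g)
    (hF : Integrable (signPot α g)) (q : 𝓢(ℝ, ℂ)) :
    ‖(∫ t, (tailPot α g t : ℂ) * q t) - tailPotBot α g * ∫ t, q t‖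
      ≤ (∫ r, |signPot α g r|) * ∫ t, ‖q t‖ := by
  have hi : Integrable fun t => (tailPot α g t : ℂ) * q t := by
    refine q.integrable.bdd_mul (c := tailPot α g 0 + ∫ r, |signPot α g r|)
      (Complex.measurable_ofReal.comp (measurable_tailPot hα hg)).aestronglyMeasurable
      (Eventually.of_forall fun t => ?_)
    rw [Complex.norm_real, norm_of_nonneg (tailPot_nonneg hg t)]
    exact tailPot_le hα hg hF t
  rw [← integral_const_mul, ← integral_sub hi (q.integrable.const_mul _), ← integral_const_mul]
  refine norm_integral_le_of_norm_le (q.integrable.norm.const_mul _)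
    (Eventually.of_forall fun t => ?_)
  rw [← sub_mul, norm_mul, ← Complex.ofReal_sub, Complex.norm_real, tailPot_eq_add hα hg hF,
    add_sub_cancel_left]
  refine mul_le_mul_of_nonneg_right ?_ (norm_nonneg _)
  exact (norm_integral_le_integral_norm _).trans
    (setIntegral_le_integral hF.norm (Eventually.of_forall fun _ => norm_nonneg _))

/-- Integration by parts: a derivative on the test function turns the tail potential into the sign
potential. -/
lemma integral_tailPot_mul_deriv (hα : 0 < α) (hg : GaussAdmissible α g)
    (hF : Integrable (signPot α g)) {q q' : 𝓢(ℝ, ℂ)} (hq : ∀ x, HasDerivAt q (q' x) x) :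
    ∫ t, (tailPot α g t : ℂ) * q' t = -∫ r, (signPot α g r : ℂ) * q r := by
  have htop : Tendsto q atTop (𝓝 0) := q.tendsto_cocompact.mono_left atTop_le_cocompact
  have hbot : Tendsto q atBot (𝓝 0) := q.tendsto_cocompact.mono_left atBot_le_cocompact
  have h0 : ∫ t, q' t = 0 := by
    rw [integral_of_hasDerivAt_of_tendsto hq q'.integrable hbot htop, sub_zero]
  have h1 : ∀ r, ∫ t in Ici r, q' t = -q r := fun r => by
    rw [integral_Ici_eq_integral_Ioi,
      integral_Ioi_of_hasDerivAt_of_tendsto' (fun x _ => hq x) q'.integrable.integrableOn htop,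
      zero_sub]
  have hm : MeasurableSet {p : ℝ × ℝ | p.2 ≤ p.1} := measurableSet_le measurable_snd measurable_fst
  have hprod : Integrable (fun p : ℝ × ℝ => q' p.1 * (signPot α g p.2 : ℂ))
      (volume.prod volume) := q'.integrable.mul_prod hF.ofReal
  have hint : Integrable (Function.uncurry fun t r : ℝ =>
      {p : ℝ × ℝ | p.2 ≤ p.1}.indicator (fun p => q' p.1 * (signPot α g p.2 : ℂ)) (t, r))
      (volume.prod volume) := hprod.indicator hm
  have h2 : ∀ t, (tailPot α g t : ℂ) * q' t = tailPotBot α g * q' t + ∫ r,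
      {p : ℝ × ℝ | p.2 ≤ p.1}.indicator (fun p => q' p.1 * (signPot α g p.2 : ℂ)) (t, r) :=
    fun t => by
    have : (∫ r, {p : ℝ × ℝ | p.2 ≤ p.1}.indicator
        (fun p => q' p.1 * (signPot α g p.2 : ℂ)) (t, r))
        = ∫ r in Iic t, q' t * (signPot α g r : ℂ) := by
      rw [← integral_indicator measurableSet_Iic]
      rfl
    rw [this, integral_const_mul, integral_complex_ofReal, tailPot_eq_add hα hg hF]
    push_cast
    ring
  have hint' : Integrable fun t : ℝ => ∫ r,
      {p : ℝ × ℝ | p.2 ≤ p.1}.indicator (fun p => q' p.1 * (signPot α g p.2 : ℂ)) (t, r) :=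
    hint.integral_prod_left
  simp_rw [h2]
  rw [integral_add (q'.integrable.const_mul _) hint', integral_const_mul, h0,
    mul_zero, zero_add, integral_integral_swap hint, ← integral_neg]
  congr 1 with r
  have : (∫ t, {p : ℝ × ℝ | p.2 ≤ p.1}.indicator
      (fun p => q' p.1 * (signPot α g p.2 : ℂ)) (t, r))
      = ∫ t in Ici r, q' t * (signPot α g r : ℂ) := by
    rw [← integral_indicator measurableSet_Ici]
    rfl
  rw [this, integral_mul_const, h1]
  ring

/-- The Gaussian averages of `g` are, up to the `L¹` norm of its sign potential, the same as those
of a constant; that constant does not depend on the width of the Gaussian. -/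
lemma exists_abs_integral_gaussian_sub_le (hα : 0 < α) {β : ℝ} (hβ : 0 < β) :
    ∃ D : ℝ, 0 ≤ D ∧ ∀ g : ℝ → ℝ, GaussAdmissible α g → Integrable (signPot α g) →
      |(∫ x, g x * exp (-β * x ^ 2)) - tailPotBot α g * (tailHat α 0)⁻¹ * √(π / β)|
        ≤ D * ∫ r, |signPot α g r| := by
  obtain ⟨q, -, hconv, -, h0⟩ := exists_deconvolution hα hβ
  refine ⟨∫ t, ‖q 0 t‖, integral_nonneg fun _ => norm_nonneg _, fun g hg hF => ?_⟩
  have h1 := norm_integral_tailPot_sub_le hα hg hF (q 0)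
  rw [← integral_mul_conv_eq hα hg hF, h0] at h1
  simp_rw [hconv 0, iteratedDeriv_zero, ← Complex.ofReal_mul] at h1
  rw [integral_complex_ofReal, ← Complex.ofReal_sub, Complex.norm_real, norm_eq_abs,
    mul_comm √(π / β), ← mul_assoc] at h1
  rwa [mul_comm (∫ t, ‖q 0 t‖)]

/-- Pairing `g` with a derivative of positive order of a Gaussian: one of the derivatives is spent on
an integration by parts, so that only the sign potential is left. -/
lemma abs_integral_iteratedDeriv_gaussian_le (hα : 0 < α) {β : ℝ} (hβ : 0 < β)
    (hg : GaussAdmissible α g) (hF : Integrable (signPot α g)) (m : ℕ) :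
    |∫ x, g x * iteratedDeriv (m + 1) (fun x : ℝ => exp (-β * x ^ 2)) x|
      ≤ (∫ r, |signPot α g r|) * ∫ ξ : ℝ, |2 * π * ξ| ^ m *
        (√(π / β) * exp (-(π ^ 2 / β) * ξ ^ 2) * (tailHat α ξ)⁻¹) := by
  obtain ⟨q, hd, hconv, hb, -⟩ := exists_deconvolution hα hβ
  have hsm : ContDiff ℝ ∞ fun x : ℝ => exp (-β * x ^ 2) := by fun_prop
  have h1 := integral_mul_conv_eq hα hg hF (q (m + 1))
  simp_rw [hconv (m + 1), iteratedDeriv_ofReal_comp hsm, ← Complex.ofReal_mul] at h1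
  rw [integral_complex_ofReal, integral_tailPot_mul_deriv hα hg hF (hd m)] at h1
  rw [← norm_eq_abs, ← Complex.norm_real, h1, norm_neg, ← integral_mul_const]
  refine norm_integral_le_of_norm_le (hF.norm.mul_const _) (Eventually.of_forall fun r => ?_)
  rw [norm_mul, Complex.norm_real]
  exact mul_le_mul_of_nonneg_left (hb m r) (norm_nonneg _)

/-! ### Gaussian moments and the Hermite normalization -/

lemma integral_abs_pow_mul_exp {d : ℝ} (hd : 0 < d) (s : ℕ) :
    ∫ ξ : ℝ, |ξ| ^ s * exp (-d ^ 2 * ξ ^ 2) = Gamma ((s + 1) / 2) / d ^ (s + 1) := by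
  have h1 := integral_comp_abs (f := fun ξ : ℝ => ξ ^ s * exp (-d ^ 2 * ξ ^ 2))
  simp only [sq_abs] at h1
  have h2 := integral_rpow_mul_exp_neg_mul_rpow (p := 2) (q := s) (b := d ^ 2) two_pos
    (by linarith [s.cast_nonneg (α := ℝ)]) (by positivity)
  have h3 : ((d ^ 2 : ℝ)) ^ (-((s : ℝ) + 1) / 2) = (d ^ (s + 1))⁻¹ := by
    rw [← rpow_natCast d 2, ← rpow_mul hd.le, ← rpow_natCast d (s + 1), ← rpow_neg hd.le]
    congr 1
    push_cast
    ring
  simp only [rpow_natCast, rpow_ofNat] at h2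
  rw [h1, h2, h3]
  ring

lemma integrable_abs_pow_mul_exp {d : ℝ} (hd : 0 < d) (s : ℕ) :
    Integrable fun ξ : ℝ => |ξ| ^ s * exp (-d ^ 2 * ξ ^ 2) := by
  have h := (integrable_rpow_mul_exp_neg_mul_sq (b := d ^ 2) (by positivity) (s := s)
    (by linarith [s.cast_nonneg (α := ℝ)])).abs
  refine h.congr (Eventually.of_forall fun u => ?_)
  simp [abs_mul, abs_pow]

/-- Legendre's duplication formula and logarithmic convexity bound the central Gamma value. -/
lemma Gamma_half_sq_le {n : ℕ} (hn : 1 ≤ n) :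
    Gamma (n / 2 + 1) ^ 2 * 2 ^ n ≤ √π * n.factorial * √n := by
  set x : ℝ := (n + 1) / 2 with hx
  have hn' : (1 : ℝ) ≤ n := by exact_mod_cast hn
  have hx0 : 0 < x := by positivity
  have hGx : 0 < Gamma x := Gamma_pos_of_pos hx0
  have hGx' : 0 < Gamma (x + 1 / 2) := Gamma_pos_of_pos (by positivity)
  have e : (n : ℝ) / 2 + 1 = x + 1 / 2 := by rw [hx]; ring
  have hdup : Gamma x * Gamma (x + 1 / 2) * 2 ^ n = n.factorial * √π := by
    rw [Gamma_mul_Gamma_add_half, show 2 * x = n + 1 by rw [hx]; ring, Gamma_nat_eq_factorial,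
      show (1 : ℝ) - (n + 1) = -(n : ℝ) by ring, rpow_neg two_pos.le, rpow_natCast]
    field_simp
  have hconv : Gamma (x + 1 / 2) ≤ √x * Gamma x := by
    have h := Gamma_mul_add_mul_le_rpow_Gamma_mul_rpow_Gamma hx0 (show 0 < x + 1 by positivity)
      one_half_pos one_half_pos (by norm_num)
    rw [Gamma_add_one hx0.ne', ← sqrt_eq_rpow, ← sqrt_eq_rpow, sqrt_mul hx0.le,
      mul_left_comm, mul_self_sqrt hGx.le] at h
    convert h using 2
    ring
  have hsx : √x ≤ √n := sqrt_le_sqrt (by rw [hx]; linarith)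
  rw [e]
  calc Gamma (x + 1 / 2) ^ 2 * 2 ^ n
      ≤ (√x * Gamma x) * Gamma (x + 1 / 2) * 2 ^ n := by
        rw [pow_two]; gcongr
    _ = √x * (n.factorial * √π) := by rw [← hdup]; ring
    _ ≤ √n * (n.factorial * √π) := by gcongr
    _ = _ := by ring

lemma sigma_pos {a : ℝ} (ha0 : 0 < a) (ha1 : a < 1) : 0 < sigma a :=
  sqrt_pos.2 (div_pos ha0 (sub_pos.2 ha1))

lemma sigma_sq {a : ℝ} (ha0 : 0 < a) (ha1 : a < 1) : sigma a ^ 2 = a / (1 - a) :=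
  sq_sqrt (div_pos ha0 (sub_pos.2 ha1)).le

lemma hermiteNorm_pos {a : ℝ} (ha0 : 0 < a) (ha1 : a < 1) (n : ℕ) : 0 < hermiteNorm a n := by
  have := sigma_pos ha0 ha1
  unfold hermiteNorm
  positivity

lemma hermiteNorm_sq {a : ℝ} (ha0 : 0 < a) (ha1 : a < 1) (n : ℕ) :
    hermiteNorm a n ^ 2 = √π * 2 ^ n * n.factorial * sigma a / sigma a ^ (2 * n) := by
  have hs := sigma_pos ha0 ha1
  have h1 : (π ^ (1 / 4 : ℝ)) ^ 2 = √π := by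
    rw [← rpow_natCast, ← rpow_mul pi_pos.le, sqrt_eq_rpow]; norm_num
  have h2 : ((2 : ℝ) ^ ((n : ℝ) / 2)) ^ 2 = 2 ^ n := by
    rw [← rpow_natCast, ← rpow_mul two_pos.le, ← rpow_natCast 2 n]; congr 1; push_cast; ring
  have h3 : (sigma a ^ ((n : ℝ) - 1 / 2)) ^ 2 = sigma a ^ (2 * n) / sigma a := by
    rw [← rpow_natCast, ← rpow_mul hs.le, ← rpow_natCast (sigma a) (2 * n)]
    rw [show ((n : ℝ) - 1 / 2) * (2 : ℕ) = (2 * n : ℕ) - 1 by push_cast; ring, rpow_sub_one hs.ne']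
  unfold hermiteNorm
  rw [div_pow, mul_pow, mul_pow, h1, h2, h3, sq_sqrt (by positivity)]
  field_simp

lemma two_div_sigma_pow_mul_Gamma_le {a : ℝ} (ha0 : 0 < a) (ha1 : a < 1) {n : ℕ} (hn : 1 ≤ n) :
    (2 / sigma a) ^ n * Gamma (n / 2 + 1)
      ≤ (√(sigma a))⁻¹ * (n : ℝ) ^ (1 / 4 : ℝ) * hermiteNorm a n := by
  have hs := sigma_pos ha0 ha1
  have hK := hermiteNorm_pos ha0 ha1 n
  have hn4 : ((n : ℝ) ^ (1 / 4 : ℝ)) ^ 2 = √n := by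
    rw [← rpow_natCast, ← rpow_mul n.cast_nonneg, sqrt_eq_rpow]; norm_num
  have hG : 0 < Gamma ((n : ℝ) / 2 + 1) := Gamma_pos_of_pos (by positivity)
  refine (pow_le_pow_iff_left₀ (by positivity) (by positivity) two_ne_zero).1 ?_
  have h := Gamma_half_sq_le hn
  rw [mul_pow, mul_pow, mul_pow, hn4, hermiteNorm_sq ha0 ha1, inv_pow, sq_sqrt hs.le, div_pow,
    div_pow, ← pow_mul, ← pow_mul, mul_comm n 2]
  calc 2 ^ (2 * n) / sigma a ^ (2 * n) * Gamma (n / 2 + 1) ^ 2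
      = 2 ^ n / sigma a ^ (2 * n) * (Gamma (n / 2 + 1) ^ 2 * 2 ^ n) := by
        rw [two_mul n, pow_add 2 n n]; ring
    _ ≤ 2 ^ n / sigma a ^ (2 * n) * (√π * n.factorial * √n) := by gcongr
    _ = _ := by field_simp

/-- The bounds on the deconvolution kernels grow like `n ^ (1 / 4)` relative to the Hermite
normalization. -/
lemma exists_integral_le_hermiteNorm (hα : 0 < α) {a : ℝ} (ha0 : 0 < a) (ha1 : a < 1) :
    ∃ C : ℝ, 0 ≤ C ∧ ∀ m : ℕ, ∫ ξ : ℝ, |2 * π * ξ| ^ m *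
        (√(π / (1 / sigma a ^ 2)) * exp (-(π ^ 2 / (1 / sigma a ^ 2)) * ξ ^ 2) * (tailHat α ξ)⁻¹)
      ≤ C * ((m + 1 : ℕ) : ℝ) ^ (1 / 4 : ℝ) * hermiteNorm a (m + 1) := by
  obtain ⟨c, hc, hle⟩ := exists_le_tailHat hα
  have hs := sigma_pos ha0 ha1
  set s := sigma a with hsdef
  have hd : 0 < π * s := by positivity
  set A := √(π / (1 / s ^ 2)) / c with hA
  have hA0 : 0 ≤ A := by positivity
  refine ⟨A * ((1 / π + 1 / (2 * π ^ 3 * s ^ 2)) * (√s)⁻¹), by positivity, fun m => ?_⟩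
  have hn : (m + 1 : ℕ) = ((m : ℝ) + 1) := by push_cast; ring
  have hbound : ∀ ξ : ℝ, |2 * π * ξ| ^ m *
        (√(π / (1 / s ^ 2)) * exp (-(π ^ 2 / (1 / s ^ 2)) * ξ ^ 2) * (tailHat α ξ)⁻¹)
      ≤ A * (2 * π) ^ m * (|ξ| ^ m * exp (-(π * s) ^ 2 * ξ ^ 2)
        + |ξ| ^ (m + 2) * exp (-(π * s) ^ 2 * ξ ^ 2)) := fun ξ => by
    have h1 : (tailHat α ξ)⁻¹ ≤ (1 + ξ ^ 2) / c := by
      rw [inv_le_comm₀ (tailHat_pos hα ξ) (by positivity), inv_div]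
      exact hle ξ
    have h2 : -(π ^ 2 / (1 / s ^ 2)) * ξ ^ 2 = -(π * s) ^ 2 * ξ ^ 2 := by field_simp
    rw [h2, abs_mul, abs_of_pos two_pi_pos, mul_pow]
    calc (2 * π) ^ m * |ξ| ^ m *
          (√(π / (1 / s ^ 2)) * exp (-(π * s) ^ 2 * ξ ^ 2) * (tailHat α ξ)⁻¹)
        ≤ (2 * π) ^ m * |ξ| ^ m *
          (√(π / (1 / s ^ 2)) * exp (-(π * s) ^ 2 * ξ ^ 2) * ((1 + ξ ^ 2) / c)) := by gcongr
      _ = _ := by rw [hA, pow_add, sq_abs]; ring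
  have hi := ((integrable_abs_pow_mul_exp hd m).add (integrable_abs_pow_mul_exp hd (m + 2))).const_mul
    (A * (2 * π) ^ m)
  have hG := two_div_sigma_pow_mul_Gamma_le ha0 ha1 (n := m + 1) (by omega)
  rw [← hsdef] at hG
  have hGnn : 0 < Gamma ((m + 1 : ℕ) / 2 + 1) := Gamma_pos_of_pos (by positivity)
  have hG1 : Gamma (((m : ℝ) + 1) / 2) ≤ 2 * Gamma ((m + 1 : ℕ) / 2 + 1) := by
    rw [Gamma_add_one (by positivity), hn]
    have : 0 < Gamma (((m : ℝ) + 1) / 2) := Gamma_pos_of_pos (by positivity)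
    nlinarith [m.cast_nonneg (α := ℝ)]
  have hG2 : Gamma (((m + 2 : ℕ) + 1 : ℝ) / 2) = Gamma ((m + 1 : ℕ) / 2 + 1) := by
    congr 1; push_cast; ring
  calc _ ≤ ∫ ξ : ℝ, A * (2 * π) ^ m * (|ξ| ^ m * exp (-(π * s) ^ 2 * ξ ^ 2)
        + |ξ| ^ (m + 2) * exp (-(π * s) ^ 2 * ξ ^ 2)) :=
        integral_mono_of_nonneg (Eventually.of_forall fun ξ => by
          have := tailHat_pos hα ξ; positivity) hi (Eventually.of_forall hbound)
    _ = A * (2 * π) ^ m * (Gamma (((m : ℝ) + 1) / 2) / (π * s) ^ (m + 1)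
        + Gamma ((m + 1 : ℕ) / 2 + 1) / (π * s) ^ (m + 3)) := by
        rw [integral_const_mul, integral_add (integrable_abs_pow_mul_exp hd m)
          (integrable_abs_pow_mul_exp hd (m + 2)), integral_abs_pow_mul_exp hd,
          integral_abs_pow_mul_exp hd, hG2]
    _ ≤ A * (2 * π) ^ m * (2 * Gamma ((m + 1 : ℕ) / 2 + 1) / (π * s) ^ (m + 1)
        + Gamma ((m + 1 : ℕ) / 2 + 1) / (π * s) ^ (m + 3)) := by gcongr
    _ = A * (1 / π + 1 / (2 * π ^ 3 * s ^ 2)) *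
          ((2 / s) ^ (m + 1) * Gamma ((m + 1 : ℕ) / 2 + 1)) := by
        rw [div_pow, mul_pow, mul_pow, mul_pow]
        have := pi_pos
        field_simp
        ring
    _ ≤ A * (1 / π + 1 / (2 * π ^ 3 * s ^ 2)) *
          ((√s)⁻¹ * ((m + 1 : ℕ) : ℝ) ^ (1 / 4 : ℝ) * hermiteNorm a (m + 1)) := by gcongr
    _ = _ := by ring

/-! ### Orthonormality of the Hermite functions -/

lemma integrable_eval_mul_gaussian {β : ℝ} (hβ : 0 < β) (P : ℝ[X]) :
    Integrable fun x : ℝ => P.eval x * exp (-β * x ^ 2) := by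
  induction P using Polynomial.induction_on' with
  | add p q hp hq =>
    refine (hp.add hq).congr (Eventually.of_forall fun x => ?_)
    simp [add_mul]
  | monomial n r =>
    have h := (integrable_rpow_mul_exp_neg_mul_sq hβ (s := n)
      (by linarith [n.cast_nonneg (α := ℝ)])).const_mul r
    refine h.congr (Eventually.of_forall fun x => ?_)
    simp [mul_assoc]

lemma memLp_eval_mul_gaussian {β : ℝ} (hβ : 0 < β) (P : ℝ[X]) :
    MemLp (fun x : ℝ => P.eval x * exp (-β * x ^ 2)) 2 := by
  rw [memLp_two_iff_integrable_sq (by fun_prop)]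
  refine (integrable_eval_mul_gaussian (β := 2 * β) (by positivity) (P ^ 2)).congr
    (Eventually.of_forall fun x => ?_)
  simp only [Polynomial.eval_pow, mul_pow, ← exp_nat_mul]
  congr 2
  push_cast
  ring

lemma natDegree_gaussPoly_le (β : ℝ) (n : ℕ) : (gaussPoly β n).natDegree ≤ n := by
  induction n with
  | zero => simp [gaussPoly]
  | succ n ih =>
    refine Polynomial.natDegree_add_le_of_degree_le ?_ ?_
    · exact (Polynomial.natDegree_derivative_le _).trans (by omega)
    · rw [mul_assoc]
      refine (Polynomial.natDegree_C_mul_le _ _).trans (Polynomial.natDegree_mul_le.trans ?_)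
      have := Polynomial.natDegree_X_le (R := ℝ)
      omega

lemma coeff_gaussPoly_self (β : ℝ) (n : ℕ) : (gaussPoly β n).coeff n = (-2 * β) ^ n := by
  induction n with
  | zero => simp [gaussPoly]
  | succ n ih =>
    have h : (gaussPoly β n).coeff (n + 1 + 1) = 0 :=
      Polynomial.coeff_eq_zero_of_natDegree_lt (by have := natDegree_gaussPoly_le β n; omega)
    rw [gaussPoly, Polynomial.coeff_add, Polynomial.coeff_derivative, h, mul_assoc,
      Polynomial.coeff_C_mul, Polynomial.coeff_X_mul, ih]
    ring

/-- Integrating by parts `n` times. -/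
lemma integral_gaussPoly_mul {β : ℝ} (hβ : 0 < β) (n : ℕ) (R : ℝ[X]) :
    ∫ x : ℝ, R.eval x * ((gaussPoly β n).eval x * exp (-β * x ^ 2))
      = (-1) ^ n * ∫ x : ℝ, (Polynomial.derivative^[n] R).eval x * exp (-β * x ^ 2) := by
  induction n generalizing R with
  | zero => simp [gaussPoly]
  | succ n ih =>
    have hi : ∀ p q : ℝ[X], Integrable
        ((fun x => p.eval x) * fun x => q.eval x * exp (-β * x ^ 2)) := fun p q => by
      refine (integrable_eval_mul_gaussian hβ (p * q)).congr (Eventually.of_forall fun x => ?_)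
      simp [mul_assoc]
    have h := integral_mul_deriv_eq_deriv_mul_of_integrable
      (u := fun x => R.eval x) (v := fun x => (gaussPoly β n).eval x * exp (-β * x ^ 2))
      (u' := fun x => (Polynomial.derivative R).eval x)
      (v' := fun x => (gaussPoly β (n + 1)).eval x * exp (-β * x ^ 2))
      (fun x _ => R.hasDerivAt x) (fun x _ => hasDerivAt_eval_mul_gaussian β _ x)
      (hi _ _) (hi _ _) (hi _ _)
    rw [h, ih, Function.iterate_succ_apply, pow_succ]
    ring

lemma integral_gaussPoly_mul_gaussPoly {β : ℝ} (hβ : 0 < β) (n m : ℕ) :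
    ∫ x : ℝ, (gaussPoly β m).eval x * ((gaussPoly β n).eval x * exp (-β * x ^ 2))
      = if n = m then (2 * β) ^ n * n.factorial * √(π / β) else 0 := by
  wlog hmn : m ≤ n generalizing n m
  · have h := this m n (le_of_not_ge hmn)
    rw [if_neg (by omega)] at h ⊢
    rw [← h]
    congr 1 with x
    ring
  rw [integral_gaussPoly_mul hβ]
  rcases hmn.lt_or_eq with hlt | rfl
  · rw [Polynomial.iterate_derivative_eq_zero ((natDegree_gaussPoly_le β m).trans_lt hlt),
      if_neg (by omega)]
    simp
  · have hc : Polynomial.derivative^[m] (gaussPoly β m)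
        = Polynomial.C (m.factorial * (-2 * β) ^ m) := by
      have hd : (Polynomial.derivative^[m] (gaussPoly β m)).natDegree ≤ 0 :=
        (Polynomial.natDegree_iterate_derivative _ _).trans
          (by have := natDegree_gaussPoly_le β m; omega)
      rw [Polynomial.eq_C_of_natDegree_le_zero hd, Polynomial.coeff_iterate_derivative, zero_add,
        Nat.descFactorial_self, coeff_gaussPoly_self, nsmul_eq_mul]
    simp only [hc, Polynomial.eval_C, if_true]
    rw [integral_const_mul, integral_gaussian, show -2 * β = (-1) * (2 * β) by ring, mul_pow]
    have : (-1 : ℝ) ^ m * (-1) ^ m = 1 := by rw [← mul_pow]; simp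
    linear_combination (m.factorial * (2 * β) ^ m * √(π / β)) * this

lemma hermiteFun_eq (a : ℝ) (n : ℕ) (x : ℝ) :
    hermiteFun a n x = (hermiteNorm a n)⁻¹ * ((gaussPoly (1 / sigma a ^ 2) n).eval x
      * exp (-(1 / (2 * sigma a ^ 2)) * x ^ 2)) := by
  have e : (fun t : ℝ => exp (-t ^ 2 / sigma a ^ 2)) = fun t => exp (-(1 / sigma a ^ 2) * t ^ 2) := by
    ext t; congr 1; ring
  rw [hermiteFun, e, iteratedDeriv_gaussian, one_div (hermiteNorm a n), mul_assoc,
    mul_left_comm (exp _), ← exp_add]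
  congr 3
  ring

lemma memLp_hermiteFun {a : ℝ} (ha0 : 0 < a) (ha1 : a < 1) (n : ℕ) :
    MemLp (hermiteFun a n) 2 := by
  have := sigma_pos ha0 ha1
  exact ((memLp_eval_mul_gaussian (β := 1 / (2 * sigma a ^ 2)) (by positivity)
    (gaussPoly (1 / sigma a ^ 2) n)).const_mul (hermiteNorm a n)⁻¹).ae_eq
    (Eventually.of_forall fun x => (hermiteFun_eq a n x).symm)

lemma integral_hermiteFun_mul {a : ℝ} (ha0 : 0 < a) (ha1 : a < 1) (n m : ℕ) :
    ∫ x, hermiteFun a n x * hermiteFun a m x = if n = m then 1 else 0 := by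
  have hs := sigma_pos ha0 ha1
  have hK := hermiteNorm_pos ha0 ha1
  have h := integral_gaussPoly_mul_gaussPoly (β := 1 / sigma a ^ 2) (by positivity) n m
  have e : ∀ x, hermiteFun a n x * hermiteFun a m x
      = (hermiteNorm a n)⁻¹ * (hermiteNorm a m)⁻¹ * ((gaussPoly (1 / sigma a ^ 2) m).eval x *
        ((gaussPoly (1 / sigma a ^ 2) n).eval x * exp (-(1 / sigma a ^ 2) * x ^ 2))) := fun x => by
    have h2 : exp (-(1 / sigma a ^ 2) * x ^ 2)
        = exp (-(1 / (2 * sigma a ^ 2)) * x ^ 2) * exp (-(1 / (2 * sigma a ^ 2)) * x ^ 2) := by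
      rw [← exp_add]; congr 1; field_simp; ring
    rw [hermiteFun_eq, hermiteFun_eq, h2]
    ring
  simp_rw [e]
  rw [integral_const_mul, h]
  split_ifs with hnm
  · subst hnm
    have h3 : √(π / (1 / sigma a ^ 2)) = √π * sigma a := by
      rw [show π / (1 / sigma a ^ 2) = π * sigma a ^ 2 by field_simp, sqrt_mul pi_pos.le,
        sqrt_sq hs.le]
    have h4 := hermiteNorm_sq ha0 ha1 n
    rw [← mul_inv, ← pow_two, h4, h3, inv_div, mul_pow, div_pow, one_pow, ← pow_mul]
    have : 0 < √π := by positivity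
    field_simp
  · simp

/-! ### Completeness of the Hermite functions -/

lemma ae_eq_zero_of_fourier_eq_zero {u : ℝ → ℂ} (hu : Integrable u) (h : ∀ ξ, 𝓕 u ξ = 0) :
    u =ᵐ[volume] 0 := by
  refine ae_eq_zero_of_integral_contDiff_smul_eq_zero hu.locallyIntegrable fun φ hφ hφc => ?_
  have hc : HasCompactSupport fun x => (φ x : ℂ) := hφc.comp_left (g := Complex.ofReal) rfl
  set ψ : 𝓢(ℝ, ℂ) := hc.toSchwartzMap (Complex.ofRealCLM.contDiff.comp hφ) with hψ
  have h1 : (𝓕 (𝓕⁻ ψ) : 𝓢(ℝ, ℂ)) = ψ := FourierTransform.fourier_fourierInv_eq ψ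
  have h2 := integral_fourier_mul_eq (𝓕⁻ ψ : 𝓢(ℝ, ℂ)).integrable hu
  rw [← SchwartzMap.fourier_coe, h1] at h2
  simp_rw [h, mul_zero, integral_zero] at h2
  rw [← h2]
  rfl

lemma integrable_mul_exp_abs {v : ℝ → ℝ} (hv : MemLp v 2) {β : ℝ} (hβ : 0 < β) (c : ℝ) :
    Integrable fun x => exp (c * |x|) * |v x * exp (-β * x ^ 2)| := by
  have h1 : MemLp (fun x : ℝ => exp (c * |x|) * exp (-β * x ^ 2)) 2 := by
    rw [memLp_two_iff_integrable_sq (by fun_prop)]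
    refine ((integrable_exp_neg_mul_sq hβ).const_mul (exp (c ^ 2 / β))).mono' (by fun_prop)
      (Eventually.of_forall fun x => ?_)
    rw [norm_of_nonneg (by positivity), ← exp_add, ← exp_nat_mul, ← exp_add]
    refine exp_le_exp.2 ?_
    have h : c ^ 2 / β + β * x ^ 2 - 2 * (c * |x|) = (c - β * |x|) ^ 2 / β := by
      rw [← sq_abs x]; field_simp; ring
    have h' : 0 ≤ (c - β * |x|) ^ 2 / β := by positivity
    push_cast
    linarith
  refine (MemLp.integrable_mul h1 hv.abs).congr (Eventually.of_forall fun x => ?_)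
  simp only [Pi.mul_apply, Pi.abs_apply, abs_mul, abs_exp]
  ring

/-- If all moments of `v exp (-β x²)` vanish, then so does `v`: the Fourier transform of this
function is given by the moments, since it decays faster than exponentially. -/
lemma ae_eq_zero_of_moments {v : ℝ → ℝ} (hv : MemLp v 2) {β : ℝ} (hβ : 0 < β)
    (h : ∀ n : ℕ, ∫ x, x ^ n * (v x * exp (-β * x ^ 2)) = 0) : v =ᵐ[volume] 0 := by
  have hm : AEStronglyMeasurable (fun x => v x * exp (-β * x ^ 2)) :=
    hv.aestronglyMeasurable.mul (by fun_prop)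
  have hui : Integrable fun x => v x * exp (-β * x ^ 2) := by
    refine (integrable_mul_exp_abs hv hβ 0).mono' hm (Eventually.of_forall fun x => ?_)
    simp
  have hexp : ∀ z : ℂ, HasSum (fun n : ℕ => z ^ n / (n.factorial : ℂ)) (Complex.exp z) := fun z => by
    rw [Complex.exp_eq_exp_ℂ]
    exact NormedSpace.expSeries_div_hasSum_exp z
  have hF : ∀ ξ, 𝓕 (fun x => ((v x * exp (-β * x ^ 2) : ℝ) : ℂ)) ξ = 0 := fun ξ => by
    have hs := hasSum_integral_of_dominated_convergence (μ := volume)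
      (F := fun (n : ℕ) (x : ℝ) => (↑(-2 * π * x * ξ) * Complex.I) ^ n / (n.factorial : ℂ)
        * ((v x * exp (-β * x ^ 2) : ℝ) : ℂ))
      (f := fun x : ℝ => Complex.exp (↑(-2 * π * x * ξ) * Complex.I)
        * ((v x * exp (-β * x ^ 2) : ℝ) : ℂ))
      (fun n x => (2 * π * |ξ| * |x|) ^ n / n.factorial * |v x * exp (-β * x ^ 2)|)
      (fun n => ?_) (fun n => Eventually.of_forall fun x => ?_) (Eventually.of_forall fun x => ?_)
      ?_ (Eventually.of_forall fun x => ?_)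
    · rw [fourier_real_eq_integral_exp_smul]
      refine hs.unique ?_
      convert hasSum_zero with n
      have e : ∀ x : ℝ, (↑(-2 * π * x * ξ) * Complex.I) ^ n / (n.factorial : ℂ)
          * ((v x * exp (-β * x ^ 2) : ℝ) : ℂ) = (↑(-2 * π * ξ) * Complex.I) ^ n / (n.factorial : ℂ)
          * ((x ^ n * (v x * exp (-β * x ^ 2)) : ℝ) : ℂ) := fun x => by
        push_cast
        ring
      simp_rw [e]
      rw [integral_const_mul, integral_complex_ofReal, h]
      simp
    · exact (Continuous.aestronglyMeasurable (by fun_prop)).mul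
        (Complex.continuous_ofReal.comp_aestronglyMeasurable hm)
    · rw [norm_mul, norm_div, norm_pow, norm_mul, Complex.norm_real, Complex.norm_real,
        Complex.norm_I, mul_one, Complex.norm_natCast, norm_eq_abs, norm_eq_abs]
      refine le_of_eq ?_
      congr 3
      rw [abs_mul, abs_mul, abs_mul, abs_neg, abs_two, abs_of_pos pi_pos]
      ring
    · exact (Real.summable_pow_div_factorial _).mul_right _
    · have e : ∀ x : ℝ, ∑' n : ℕ, (2 * π * |ξ| * |x|) ^ n / (n.factorial : ℝ)
          * |v x * exp (-β * x ^ 2)| = exp (2 * π * |ξ| * |x|) * |v x * exp (-β * x ^ 2)| :=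
        fun x => by
        rw [tsum_mul_right, exp_eq_exp_ℝ, (NormedSpace.expSeries_div_hasSum_exp _).tsum_eq]
      simp_rw [e]
      exact integrable_mul_exp_abs hv hβ _
    · exact (hexp _).mul_right _
  filter_upwards [ae_eq_zero_of_fourier_eq_zero hui.ofReal hF] with x hx
  simpa [(exp_pos _).ne'] using hx

/-- Completeness: as `gaussPoly β n` has degree exactly `n`, all moments are combinations of Hermite
coefficients. -/
lemma ae_eq_zero_of_hermiteCoeff {a : ℝ} (ha0 : 0 < a) (ha1 : a < 1) {v : ℝ → ℝ} (hv : MemLp v 2)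
    (h : ∀ n, hermiteCoeff a v n = 0) : v =ᵐ[volume] 0 := by
  have hs := sigma_pos ha0 ha1
  set b := 1 / sigma a ^ 2 with hb
  set β := 1 / (2 * sigma a ^ 2) with hβ
  have hb0 : 0 < b := by positivity
  have hβ0 : 0 < β := by positivity
  have hint : ∀ P : ℝ[X], Integrable fun x => P.eval x * (v x * exp (-β * x ^ 2)) := fun P => by
    refine (MemLp.integrable_mul (memLp_eval_mul_gaussian hβ0 P) hv).congr
      (Eventually.of_forall fun x => ?_)
    simp only [Pi.mul_apply]
    ring
  have hP : ∀ n, ∫ x, (gaussPoly b n).eval x * (v x * exp (-β * x ^ 2)) = 0 := fun n => by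
    have h1 := h n
    have e : ∀ x, v x * hermiteFun a n x
        = (hermiteNorm a n)⁻¹ * ((gaussPoly b n).eval x * (v x * exp (-β * x ^ 2))) := fun x => by
      rw [hermiteFun_eq]; ring
    rw [hermiteCoeff] at h1
    simp_rw [e] at h1
    rw [integral_const_mul] at h1
    exact (mul_eq_zero.1 h1).resolve_left (inv_ne_zero (hermiteNorm_pos ha0 ha1 n).ne')
  have hall : ∀ n : ℕ, ∀ P : ℝ[X], P.natDegree ≤ n →
      ∫ x, P.eval x * (v x * exp (-β * x ^ 2)) = 0 := by
    have hstep : ∀ (n : ℕ) (P : ℝ[X]) (c : ℝ),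
        ∫ x, (P - Polynomial.C c * gaussPoly b n).eval x * (v x * exp (-β * x ^ 2)) = 0 →
        ∫ x, P.eval x * (v x * exp (-β * x ^ 2)) = 0 := fun n P c h0 => by
      have e : ∀ x, P.eval x * (v x * exp (-β * x ^ 2))
          = (P - Polynomial.C c * gaussPoly b n).eval x * (v x * exp (-β * x ^ 2))
            + c * ((gaussPoly b n).eval x * (v x * exp (-β * x ^ 2))) := fun x => by
        simp only [Polynomial.eval_sub, Polynomial.eval_mul, Polynomial.eval_C]; ring
      simp_rw [e]
      rw [integral_add (hint _) ((hint _).const_mul c), integral_const_mul, h0, hP]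
      simp
    intro n
    induction n with
    | zero =>
      intro P hPd
      refine hstep 0 P (P.coeff 0) ?_
      rw [Polynomial.eq_C_of_natDegree_le_zero hPd]
      simp [gaussPoly]
    | succ n ih =>
      intro P hPd
      have hlead : (-2 * b) ^ (n + 1) ≠ 0 := pow_ne_zero _ (by linarith)
      refine hstep (n + 1) P (P.coeff (n + 1) / (-2 * b) ^ (n + 1)) (ih _ ?_)
      have hle : (P - Polynomial.C (P.coeff (n + 1) / (-2 * b) ^ (n + 1))
          * gaussPoly b (n + 1)).natDegree ≤ n + 1 := by
        simpa using Polynomial.natDegree_sub_le_of_le hPd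
          ((Polynomial.natDegree_C_mul_le (P.coeff (n + 1) / (-2 * b) ^ (n + 1)) _).trans
            (natDegree_gaussPoly_le b (n + 1)))
      have hco : (P - Polynomial.C (P.coeff (n + 1) / (-2 * b) ^ (n + 1))
          * gaussPoly b (n + 1)).coeff (n + 1) = 0 := by
        rw [Polynomial.coeff_sub, Polynomial.coeff_C_mul, coeff_gaussPoly_self,
          div_mul_cancel₀ _ hlead, sub_self]
      exact Polynomial.natDegree_le_pred hle hco
  refine ae_eq_zero_of_moments hv hβ0 fun n => ?_
  simpa using hall n (Polynomial.X ^ n) (by simp)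

/-- Parseval's identity for the Hermite functions. -/
lemma hasSum_hermiteCoeff_sq {a : ℝ} (ha0 : 0 < a) (ha1 : a < 1) {v : ℝ → ℝ} (hv : MemLp v 2) :
    HasSum (fun n => hermiteCoeff a v n ^ 2) (∫ x, v x ^ 2) := by
  set H : ℕ → Lp ℝ 2 (volume : Measure ℝ) := fun n => (memLp_hermiteFun ha0 ha1 n).toLp _ with hH
  have hin : ∀ n (w : Lp ℝ 2 (volume : Measure ℝ)), inner ℝ (H n) w = hermiteCoeff a w n :=
    fun n w => by
    rw [L2.inner_def, hermiteCoeff]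
    refine integral_congr_ae ?_
    filter_upwards [(memLp_hermiteFun ha0 ha1 n).coeFn_toLp] with x hx
    rw [hH, hx]
    simp
  have hon : Orthonormal ℝ H := by
    rw [orthonormal_iff_ite]
    intro i j
    rw [hin, hermiteCoeff, ← integral_hermiteFun_mul ha0 ha1 i j]
    refine integral_congr_ae ?_
    filter_upwards [(memLp_hermiteFun ha0 ha1 j).coeFn_toLp] with x hx
    rw [hH, hx, mul_comm]
  have hbot : (Submodule.span ℝ (range H))ᗮ = ⊥ := by
    rw [Submodule.eq_bot_iff]
    intro w hw
    rw [Submodule.mem_orthogonal] at hw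
    have h0 : ∀ n, hermiteCoeff a w n = 0 := fun n => by
      rw [← hin]; exact hw _ (Submodule.subset_span ⟨n, rfl⟩)
    exact (Lp.eq_zero_iff_ae_eq_zero).2 (ae_eq_zero_of_hermiteCoeff ha0 ha1 (Lp.memLp w) h0)
  set w : Lp ℝ 2 (volume : Measure ℝ) := hv.toLp v with hw
  have hsum := (HilbertBasis.mkOfOrthogonalEqBot hon hbot).hasSum_inner_mul_inner w w
  have hwc : ∀ n, hermiteCoeff a w n = hermiteCoeff a v n := fun n => by
    refine integral_congr_ae ?_
    filter_upwards [hv.coeFn_toLp] with x hx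
    rw [hx]
  have hww : inner ℝ w w = ∫ x, v x ^ 2 := by
    rw [L2.inner_def]
    refine integral_congr_ae ?_
    filter_upwards [hv.coeFn_toLp] with x hx
    rw [hw, hx]
    simp [pow_two]
  rw [hww] at hsum
  refine hsum.congr_fun fun n => ?_
  rw [HilbertBasis.coe_mkOfOrthogonalEqBot, real_inner_comm, hin, hwc, pow_two]

lemma hermiteCoeff_sub {a : ℝ} (ha0 : 0 < a) (ha1 : a < 1) {f : ℝ → ℝ} (hf : MemLp f 2) (n : ℕ) :
    hermiteCoeff a (fun x => f x - hermiteCoeff a f 0 * hermiteFun a 0 x) n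
      = if n = 0 then 0 else hermiteCoeff a f n := by
  have h1 := MemLp.integrable_mul hf (memLp_hermiteFun ha0 ha1 n)
  have h2 := MemLp.integrable_mul (memLp_hermiteFun ha0 ha1 0) (memLp_hermiteFun ha0 ha1 n)
  have e : ∀ x, (f x - hermiteCoeff a f 0 * hermiteFun a 0 x) * hermiteFun a n x
      = (f * hermiteFun a n) x - hermiteCoeff a f 0 * (hermiteFun a 0 * hermiteFun a n) x :=
    fun x => by simp only [Pi.mul_apply]; ring
  rw [hermiteCoeff]
  simp_rw [e]
  rw [integral_sub h1 (h2.const_mul _), integral_const_mul]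
  simp only [Pi.mul_apply]
  rw [integral_hermiteFun_mul ha0 ha1]
  split_ifs with h h' h'
  · subst h; simp [hermiteCoeff]
  · omega
  · omega
  · simp [hermiteCoeff]

/-! ### The conditional median -/

variable {f ψ : ℝ → ℝ}

lemma setIntegral_of_isMedian (hf : IsProbDensity f) {y m : ℝ} (hm : IsMedian (condLaw f y) m) :
    ∫ x in Iic m, f x * gaussianPDFReal x 1 y = ∫ x in Ioi m, f x * gaussianPDFReal x 1 y := by
  have hpos := hf.outputDensity_pos y
  have hnn : ∀ x, 0 ≤ f x * gaussianPDFReal x 1 y := fun x =>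
    mul_nonneg (hf.nonneg x) (gaussianPDFReal_nonneg _ _ _)
  have key : ∀ A : Set ℝ, MeasurableSet A → 1 / 2 ≤ condLaw f y A →
      outputDensity f y / 2 ≤ ∫ x in A, f x * gaussianPDFReal x 1 y := fun A hA h => by
    have h1 := hf.condLaw_mul y hA
    rw [← ofReal_integral_eq_lintegral_ofReal (hf.integrable_mul y).integrableOn
      (Eventually.of_forall hnn)] at h1
    have h2 : ENNReal.ofReal (outputDensity f y / 2)
        ≤ ENNReal.ofReal (∫ x in A, f x * gaussianPDFReal x 1 y) := by
      rw [← h1, div_eq_inv_mul, ENNReal.ofReal_mul (by norm_num)]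
      gcongr
      rw [ENNReal.ofReal_inv_of_pos two_pos, ← one_div]
      simpa using h
    exact (ENNReal.ofReal_le_ofReal_iff (setIntegral_nonneg hA fun x _ => hnn x)).1 h2
  have h1 := key _ measurableSet_Iic hm.1
  have h2 := key _ measurableSet_Ici hm.2
  rw [integral_Ici_eq_integral_Ioi] at h2
  have h3 : (∫ x in Iic m, f x * gaussianPDFReal x 1 y)
      + ∫ x in Ioi m, f x * gaussianPDFReal x 1 y = outputDensity f y := by
    rw [← compl_Iic, integral_add_compl measurableSet_Iic (hf.integrable_mul y), outputDensity]
  linarith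

/-- The likelihood ratio of the Gaussian channel. -/
lemma gaussianPDFReal_eq_mul (x y y' : ℝ) :
    gaussianPDFReal x 1 y'
      = gaussianPDFReal x 1 y * exp ((y' - y) * x + (y ^ 2 - y' ^ 2) / 2) := by
  simp only [gaussianPDFReal_def, NNReal.coe_one, mul_one]
  rw [mul_assoc, ← exp_add]
  congr 2
  ring

/-- Conditional medians are nondecreasing, since the likelihood ratio is increasing. -/
lemma IsCondMedian.monotone (hf : IsProbDensity f) (hψ : IsCondMedian f ψ) : Monotone ψ := by
  intro y y' hyy
  rcases hyy.eq_or_lt with rfl | hlt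
  · exact le_rfl
  by_contra! hcon
  set m := ψ y' with hm
  set p : ℝ → ℝ := fun x => f x * gaussianPDFReal x 1 y with hp
  set r : ℝ → ℝ := fun x => exp ((y' - y) * x + (y ^ 2 - y' ^ 2) / 2) with hr
  have hpi : Integrable p := hf.integrable_mul y
  have hpnn : ∀ x, 0 ≤ p x := fun x => mul_nonneg (hf.nonneg x) (gaussianPDFReal_nonneg _ _ _)
  have hpr : ∀ x, f x * gaussianPDFReal x 1 y' = r x * p x := fun x => by
    rw [gaussianPDFReal_eq_mul x y y']; simp only [hp, hr]; ring
  have hpri : Integrable fun x => r x * p x :=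
    (hf.integrable_mul y').congr (Eventually.of_forall hpr)
  have h1 := setIntegral_of_isMedian hf (hψ y)
  have h2 := setIntegral_of_isMedian hf (hψ y')
  simp_rw [hpr] at h2
  have h3 : ∫ x in Iic m, p x ≤ ∫ x in Ioi m, p x :=
    calc ∫ x in Iic m, p x ≤ ∫ x in Iic (ψ y), p x :=
          setIntegral_mono_set hpi.integrableOn (Eventually.of_forall hpnn)
            (Iic_subset_Iic.2 hcon.le).eventuallyLE
      _ = ∫ x in Ioi (ψ y), p x := h1
      _ ≤ _ := setIntegral_mono_set hpi.integrableOn (Eventually.of_forall hpnn)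
            (Ioi_subset_Ioi hcon.le).eventuallyLE
  have hrm : 0 < r m := exp_pos _
  have h4 : ∫ x in Iic m, r x * p x ≤ r m * ∫ x in Iic m, p x := by
    rw [← integral_const_mul]
    refine setIntegral_mono_on hpri.integrableOn (hpi.const_mul _).integrableOn measurableSet_Iic
      fun x hx => mul_le_mul_of_nonneg_right ?_ (hpnn x)
    have := mul_le_mul_of_nonneg_left (show x ≤ m from hx) (sub_pos.2 hlt).le
    exact exp_le_exp.2 (by linarith)
  have hnn : ∀ x ∈ Ioi m, 0 ≤ (r x - r m) * p x := fun x hx => by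
    refine mul_nonneg (sub_nonneg.2 (exp_le_exp.2 ?_)) (hpnn x)
    have := mul_le_mul_of_nonneg_left (show m ≤ x from le_of_lt hx) (sub_pos.2 hlt).le
    linarith
  have hint : Integrable fun x => (r x - r m) * p x :=
    (hpri.sub (hpi.const_mul (r m))).congr (Eventually.of_forall fun x => by
      simp only [Pi.sub_apply]; ring)
  have h5 : ∫ x in Ioi m, (r x - r m) * p x
      = (∫ x in Ioi m, r x * p x) - r m * ∫ x in Ioi m, p x := by
    rw [← integral_const_mul, ← integral_sub hpri.integrableOn (hpi.const_mul _).integrableOn]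
    congr 1 with x
    ring
  have h6 : ∫ x in Ioi m, (r x - r m) * p x = 0 := by
    refine le_antisymm ?_ (setIntegral_nonneg measurableSet_Ioi hnn)
    have := mul_le_mul_of_nonneg_left h3 hrm.le
    linarith
  have h7 : ∫ x in Ioi m, p x = 0 := by
    rw [setIntegral_eq_zero_iff_of_nonneg_ae
      ((ae_restrict_iff' measurableSet_Ioi).2 (Eventually.of_forall hnn)) hint.integrableOn] at h6
    refine integral_eq_zero_of_ae ?_
    filter_upwards [h6, ae_restrict_mem measurableSet_Ioi] with x hx hxm
    have : r m < r x := by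
      refine exp_lt_exp.2 ?_
      have := mul_lt_mul_of_pos_left (show m < x from hxm) (sub_pos.2 hlt)
      linarith
    exact (mul_eq_zero.1 hx).resolve_left (sub_pos.2 this).ne'
  have h8 : (∫ x in Iic m, p x) + ∫ x in Ioi m, p x = outputDensity f y := by
    rw [← compl_Iic, integral_add_compl measurableSet_Iic hpi, outputDensity]
  have := hf.outputDensity_pos y
  linarith

/-- The tilted density `f(x) exp (x² / (2σ²))`, with `σ² = a / (1 - a)`; it is constant if `f` is
the density of `N(0, σ²)`. -/
def tilt (a : ℝ) (f : ℝ → ℝ) (x : ℝ) : ℝ := f x * exp (1 / (2 * sigma a ^ 2) * x ^ 2)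

variable {a : ℝ}

/-- Completing the square. -/
lemma tilt_mul_exp (ha0 : 0 < a) (ha1 : a < 1) (f : ℝ → ℝ) (x y : ℝ) :
    tilt a f x * exp (-(1 / (2 * a)) * (x - a * y) ^ 2)
      = f x * exp ((1 - a) / 2 * y ^ 2 - (x - y) ^ 2 / 2) := by
  have h1 : 1 - a ≠ 0 := (sub_pos.2 ha1).ne'
  rw [tilt, mul_assoc, ← exp_add, sigma_sq ha0 ha1]
  congr 2
  field_simp
  ring

lemma tilt_mul_exp_eq_gaussianPDFReal (ha0 : 0 < a) (ha1 : a < 1) (f : ℝ → ℝ) (x y : ℝ) :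
    tilt a f x * exp (-(1 / (2 * a)) * (x - a * y) ^ 2)
      = √(2 * π) * exp ((1 - a) / 2 * y ^ 2) * (f x * gaussianPDFReal x 1 y) := by
  have h : 0 < √(2 * π) := by positivity
  rw [tilt_mul_exp ha0 ha1, gaussianPDFReal_def]
  simp only [NNReal.coe_one, mul_one]
  rw [sub_eq_add_neg, exp_add, show -((x - y) ^ 2 / 2) = -(y - x) ^ 2 / 2 by ring]
  field_simp

lemma tilt_mul_exp_le (ha0 : 0 < a) (ha1 : a < 1) (hf : IsProbDensity f) (x t : ℝ) :
    tilt a f x * exp (-(1 / (2 * a)) * (x - t) ^ 2)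
      ≤ f x * exp ((1 - a) / (2 * a ^ 2) * t ^ 2) := by
  have h := tilt_mul_exp ha0 ha1 f x (t / a)
  rw [mul_div_cancel₀ _ ha0.ne'] at h
  rw [h]
  refine mul_le_mul_of_nonneg_left (exp_le_exp.2 ?_) (hf.nonneg x)
  have e : (1 - a) / 2 * (t / a) ^ 2 = (1 - a) / (2 * a ^ 2) * t ^ 2 := by field_simp
  rw [e]
  linarith [sq_nonneg (x - t / a)]

lemma measurable_tilt (hf : IsProbDensity f) : Measurable (tilt a f) :=
  hf.measurable.mul (by fun_prop)

lemma tilt_nonneg (hf : IsProbDensity f) (x : ℝ) : 0 ≤ tilt a f x :=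
  mul_nonneg (hf.nonneg x) (exp_pos _).le

lemma integral_eq_one_of_isProbDensity (hf : IsProbDensity f) : ∫ x, f x = 1 := by
  rw [integral_eq_lintegral_of_nonneg_ae (Eventually.of_forall hf.nonneg)
    hf.measurable.aestronglyMeasurable, hf.lintegral_eq_one, ENNReal.toReal_one]

lemma integrable_tilt_mul_exp (ha0 : 0 < a) (ha1 : a < 1) (hf : IsProbDensity f) (t : ℝ) :
    Integrable fun x => tilt a f x * exp (-(1 / (2 * a)) * (x - t) ^ 2) :=
  (hf.integrable.mul_const _).mono'
    ((measurable_tilt hf).mul (by fun_prop)).aestronglyMeasurable (Eventually.of_forall fun x => by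
      rw [norm_of_nonneg (mul_nonneg (tilt_nonneg hf x) (exp_pos _).le)]
      exact tilt_mul_exp_le ha0 ha1 hf x t)

lemma integral_tilt_mul_exp_le (ha0 : 0 < a) (ha1 : a < 1) (hf : IsProbDensity f) (t : ℝ) :
    ∫ x, tilt a f x * exp (-(1 / (2 * a)) * (x - t) ^ 2)
      ≤ exp ((1 - a) / (2 * a ^ 2) * t ^ 2) := by
  refine (integral_mono (integrable_tilt_mul_exp ha0 ha1 hf t) (hf.integrable.mul_const _)
    (tilt_mul_exp_le ha0 ha1 hf · t)).trans ?_
  rw [integral_mul_const, integral_eq_one_of_isProbDensity hf, one_mul]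

lemma gaussAdmissible_tilt (ha0 : 0 < a) (ha1 : a < 1) (hf : IsProbDensity f) :
    GaussAdmissible (1 / (2 * a)) (tilt a f) where
  measurable := measurable_tilt hf
  nonneg := tilt_nonneg hf
  integrable := integrable_tilt_mul_exp ha0 ha1 hf
  exists_le := ⟨_, integral_tilt_mul_exp_le ha0 ha1 hf⟩

lemma tailPot_tilt_zero_le (ha0 : 0 < a) (ha1 : a < 1) (hf : IsProbDensity f) :
    tailPot (1 / (2 * a)) (tilt a f) 0 ≤ √(π / (1 / (2 * a))) / 2 := by
  have hα : 0 < 1 / (2 * a) := by positivity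
  have hi := integrable_tilt_mul_exp ha0 ha1 hf 0
  have h1 := integral_tilt_mul_exp_le ha0 ha1 hf 0
  calc tailPot (1 / (2 * a)) (tilt a f) 0
      ≤ ∫ x, √(π / (1 / (2 * a))) / 2 * (tilt a f x * exp (-(1 / (2 * a)) * (x - 0) ^ 2)) := by
        refine integral_mono ((gaussAdmissible_tilt ha0 ha1 hf).integrable_tail hα 0)
          (hi.const_mul _) fun x => ?_
        rw [mul_left_comm]
        exact mul_le_mul_of_nonneg_left (gaussTail_le hα _) (tilt_nonneg hf x)
    _ ≤ √(π / (1 / (2 * a))) / 2 * 1 := by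
        rw [integral_const_mul]
        refine mul_le_mul_of_nonneg_left (h1.trans ?_) (by positivity)
        simp
    _ = _ := mul_one _

/-- By the defining property of the median, the sign potential at `a y` only sees the points between
`a y` and `ψ y`. -/
lemma abs_signPot_tilt_le (ha0 : 0 < a) (ha1 : a < 1) (hf : IsProbDensity f) {y m : ℝ}
    (hm : IsMedian (condLaw f y) m) :
    |signPot (1 / (2 * a)) (tilt a f) (a * y)|
      ≤ ∫ x in Ioo (min (a * y) m) (max (a * y) m),
        2 * (tilt a f x * exp (-(1 / (2 * a)) * (x - a * y) ^ 2)) := by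
  set k : ℝ → ℝ := fun x => tilt a f x * exp (-(1 / (2 * a)) * (x - a * y) ^ 2) with hk
  have hki : Integrable k := integrable_tilt_mul_exp ha0 ha1 hf _
  have hknn : ∀ x, 0 ≤ k x := fun x => mul_nonneg (tilt_nonneg hf x) (exp_pos _).le
  have hmed : ∫ x in Iic m, k x = ∫ x in Ioi m, k x := by
    simp only [hk, tilt_mul_exp_eq_gaussianPDFReal ha0 ha1]
    rw [integral_const_mul, integral_const_mul, setIntegral_of_isMedian hf hm]
  -- The integrand with `sign (x - m)` in place of `sign (x - a y)`, which has integral `0`.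
  set s : ℝ → ℝ := fun x => (Ioi m).indicator k x - (Iic m).indicator k x with hs
  have hsi : Integrable s :=
    (hki.indicator measurableSet_Ioi).sub (hki.indicator measurableSet_Iic)
  have hs0 : ∫ x, s x = 0 := by
    simp only [hs]
    rw [integral_sub (hki.indicator measurableSet_Ioi) (hki.indicator measurableSet_Iic),
      integral_indicator measurableSet_Ioi, integral_indicator measurableSet_Iic, hmed, sub_self]
  have hFi : Integrable fun x => tilt a f x *
      ((SignType.sign (x - a * y) : ℝ) * exp (-(1 / (2 * a)) * (x - a * y) ^ 2)) := by
    have hg := gaussAdmissible_tilt ha0 ha1 hf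
    exact (hg.integrable (a * y)).mono' ((measurable_signKernel hg).comp
      (measurable_const.prodMk measurable_id)).aestronglyMeasurable
      (Eventually.of_forall fun x => norm_signKernel_le hg x (a * y))
  have hF : signPot (1 / (2 * a)) (tilt a f) (a * y) = ∫ x, (tilt a f x *
      ((SignType.sign (x - a * y) : ℝ) * exp (-(1 / (2 * a)) * (x - a * y) ^ 2)) - s x) := by
    rw [integral_sub hFi hsi, hs0, sub_zero, signPot]
  rw [hF, ← norm_eq_abs, ← integral_indicator measurableSet_Ioo]
  refine norm_integral_le_of_norm_le ((hki.const_mul 2).indicator measurableSet_Ioo) ?_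
  have hne : ∀ c : ℝ, ∀ᵐ x : ℝ, x ≠ c := fun c => by simp [ae_iff]
  filter_upwards [hne (a * y), hne m] with x hx1 hx2
  have hkx := hknn x
  have e : tilt a f x * ((SignType.sign (x - a * y) : ℝ)
      * exp (-(1 / (2 * a)) * (x - a * y) ^ 2)) = (SignType.sign (x - a * y) : ℝ) * k x := by
    simp only [hk]; ring
  rw [e, norm_eq_abs]
  rcases lt_or_gt_of_ne hx1 with h1 | h1 <;> rcases lt_or_gt_of_ne hx2 with h2 | h2
  · rw [sign_neg (sub_neg.2 h1)]
    have : x ∉ Ioo (min (a * y) m) (max (a * y) m) := fun h => by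
      have := h.1; simp only [min_lt_iff] at this; rcases this with h | h <;> linarith
    simp [hs, h2.le, h2.not_gt, indicator_of_notMem this]
  · rw [sign_neg (sub_neg.2 h1)]
    have : x ∈ Ioo (min (a * y) m) (max (a * y) m) := ⟨min_lt_iff.2 (Or.inr h2),
      lt_max_iff.2 (Or.inl h1)⟩
    rw [indicator_of_mem this]
    simp only [hs, indicator_of_mem (show x ∈ Ioi m from h2),
      indicator_of_notMem (show x ∉ Iic m from not_le.2 h2)]
    change _ ≤ 2 * k x
    rw [abs_le]
    simp only [SignType.coe_neg_one]
    constructor <;> linarith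
  · rw [sign_pos (sub_pos.2 h1)]
    have : x ∈ Ioo (min (a * y) m) (max (a * y) m) := ⟨min_lt_iff.2 (Or.inl h1),
      lt_max_iff.2 (Or.inr h2)⟩
    rw [indicator_of_mem this]
    simp only [hs, indicator_of_mem (show x ∈ Iic m from h2.le),
      indicator_of_notMem (show x ∉ Ioi m from not_lt.2 h2.le)]
    change _ ≤ 2 * k x
    rw [abs_le]
    simp only [SignType.coe_one]
    constructor <;> linarith
  · rw [sign_pos (sub_pos.2 h1)]
    have : x ∉ Ioo (min (a * y) m) (max (a * y) m) := fun h => by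
      have := h.2; simp only [lt_max_iff] at this; rcases this with h | h <;> linarith
    simp [hs, h2, h2.not_ge, indicator_of_notMem this]

/-! ### The generalized inverse of the conditional median -/

section Inverse

variable {b : ℤ → ℝ} {ε : ℝ}

lemma nonneg_of_inverse_close (hb : ∀ x, |genInv ψ x - x / a| ≤ b ⌊x⌋) (i : ℤ) : 0 ≤ b i := by
  have := hb i
  rw [Int.floor_intCast] at this
  exact (abs_nonneg _).trans this

lemma le_of_inverse_close (hb : ∀ x, |genInv ψ x - x / a| ≤ b ⌊x⌋) (hs : Summable b)
    (hε : ∑' i, b i ≤ ε) (i : ℤ) : b i ≤ ε :=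
  (hs.le_tsum i fun j _ => nonneg_of_inverse_close hb j).trans hε

lemma abs_genInv_sub_le (hb : ∀ x, |genInv ψ x - x / a| ≤ b ⌊x⌋) (hs : Summable b)
    (hε : ∑' i, b i ≤ ε) (x : ℝ) : |genInv ψ x - x / a| ≤ ε :=
  (hb x).trans (le_of_inverse_close hb hs hε _)

lemma bddAbove_sublevel (ha0 : 0 < a) (hb : ∀ x, |genInv ψ x - x / a| ≤ b ⌊x⌋) (hs : Summable b)
    (hε : ∑' i, b i ≤ ε) (x : ℝ) : BddAbove {y | ψ y ≤ x} := by
  by_contra hcon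
  -- Otherwise `genInv ψ` takes the default value `0` at all larger points, too.
  set z := max x (a * (ε + 1)) with hz
  have hz' : ¬BddAbove {y | ψ y ≤ z} := fun h =>
    hcon (h.mono fun y (hy : ψ y ≤ x) => hy.trans (le_max_left _ _))
  have h1 := abs_genInv_sub_le hb hs hε z
  rw [genInv, Real.sSup_of_not_bddAbove hz', zero_sub, abs_neg] at h1
  have h2 : ε + 1 ≤ z / a := by
    rw [le_div_iff₀ ha0, mul_comm]; exact le_max_right _ _
  linarith [le_abs_self (z / a)]

lemma nonempty_sublevel (ha0 : 0 < a) (hb : ∀ x, |genInv ψ x - x / a| ≤ b ⌊x⌋) (hs : Summable b)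
    (hε : ∑' i, b i ≤ ε) (x : ℝ) : {y | ψ y ≤ x}.Nonempty := by
  by_contra hcon
  rw [not_nonempty_iff_eq_empty] at hcon
  set z := min x (-(a * (ε + 1))) with hz
  have hz' : {y | ψ y ≤ z} = ∅ := by
    rw [eq_empty_iff_forall_notMem] at hcon ⊢
    exact fun y (hy : ψ y ≤ z) => hcon y (hy.trans (min_le_left _ _))
  have h1 := abs_genInv_sub_le hb hs hε z
  rw [genInv, hz', Real.sSup_empty, zero_sub, abs_neg] at h1
  have h2 : z / a ≤ -(ε + 1) := by
    rw [div_le_iff₀ ha0]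
    refine (min_le_right _ _).trans (le_of_eq (by ring))
  linarith [neg_le_abs (z / a)]

lemma le_genInv (ha0 : 0 < a) (hb : ∀ x, |genInv ψ x - x / a| ≤ b ⌊x⌋) (hs : Summable b)
    (hε : ∑' i, b i ≤ ε) {x y : ℝ} (h : ψ y ≤ x) : y ≤ genInv ψ x :=
  le_csSup (bddAbove_sublevel ha0 hb hs hε x) h

lemma genInv_le (ha0 : 0 < a) (hψ : Monotone ψ) (hb : ∀ x, |genInv ψ x - x / a| ≤ b ⌊x⌋)
    (hs : Summable b) (hε : ∑' i, b i ≤ ε) {x y : ℝ} (h : x < ψ y) : genInv ψ x ≤ y :=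
  csSup_le (nonempty_sublevel ha0 hb hs hε x) fun _ hz =>
    (hψ.reflect_lt (lt_of_le_of_lt hz h)).le

/-- A uniformly small distance of `ψ⁻¹` to a linear function passes to `ψ` itself. -/
lemma abs_median_sub_le (ha0 : 0 < a) (hψ : Monotone ψ)
    (hb : ∀ x, |genInv ψ x - x / a| ≤ b ⌊x⌋) (hs : Summable b) (hε : ∑' i, b i ≤ ε) (y : ℝ) :
    |ψ y - a * y| ≤ a * ε := by
  rw [abs_le]
  constructor
  · have h1 := le_genInv ha0 hb hs hε (le_refl (ψ y))
    have h2 := (abs_le.1 (abs_genInv_sub_le hb hs hε (ψ y))).2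
    have h3 : y - ε ≤ ψ y / a := by linarith
    rw [le_div_iff₀ ha0] at h3
    linarith
  · have : ψ y ≤ a * y + a * ε := by
      refine le_of_forall_lt fun x hx => ?_
      obtain ⟨z, hxz, hz⟩ := exists_between hx
      have h1 := genInv_le ha0 hψ hb hs hε hz
      have h2 := (abs_le.1 (abs_genInv_sub_le hb hs hε z)).1
      have h3 : z / a ≤ y + ε := by linarith
      rw [div_le_iff₀ ha0] at h3
      linarith
    linarith

/-- If `x` is strictly between `a y` and `ψ y`, then `y` is between `x / a` and `ψ⁻¹ x`. -/
lemma abs_sub_div_le (ha0 : 0 < a) (hψ : Monotone ψ)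
    (hb : ∀ x, |genInv ψ x - x / a| ≤ b ⌊x⌋) (hs : Summable b) (hε : ∑' i, b i ≤ ε) {x y : ℝ}
    (hx : x ∈ Ioo (min (a * y) (ψ y)) (max (a * y) (ψ y))) : |y - x / a| ≤ b ⌊x⌋ := by
  have h0 := abs_le.1 (hb x)
  obtain ⟨h1, h2⟩ := hx
  rcases le_total (a * y) (ψ y) with h | h
  · rw [min_eq_left h] at h1
    rw [max_eq_right h] at h2
    have h3 := genInv_le ha0 hψ hb hs hε h2
    have h4 : y < x / a := by rw [lt_div_iff₀ ha0]; linarith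
    have := nonneg_of_inverse_close hb ⌊x⌋
    rw [abs_le]
    constructor <;> linarith
  · rw [min_eq_right h] at h1
    rw [max_eq_left h] at h2
    have h3 := le_genInv ha0 hb hs hε h1.le
    have h4 : x / a < y := by rw [div_lt_iff₀ ha0]; linarith
    have := nonneg_of_inverse_close hb ⌊x⌋
    rw [abs_le]
    constructor <;> linarith

end Inverse

/-! ### The sign potential is small in `L¹` -/

lemma integrable_and_integral_abs_le_of_comp_mul {s : ℝ → ℝ} (ha0 : 0 < a) (hs : Measurable s)
    {c : ℝ} (hc : 0 ≤ c) (h : ∫⁻ y, ‖s (a * y)‖ₑ ≤ ENNReal.ofReal c) :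
    Integrable s ∧ ∫ t, |s t| ≤ a * c := by
  have hi : Integrable fun y => s (a * y) :=
    ⟨(hs.comp (measurable_const_mul a)).aestronglyMeasurable,
      lt_of_le_of_lt h ENNReal.ofReal_lt_top⟩
  refine ⟨(integrable_comp_mul_left_iff s ha0.ne').1 hi, ?_⟩
  have h1 : ∫ y, |s (a * y)| ≤ c := by
    have e : ∫ y, |s (a * y)| = (∫⁻ y, ‖s (a * y)‖ₑ).toReal :=
      integral_norm_eq_lintegral_enorm hi.aestronglyMeasurable
    rw [e]
    exact ENNReal.toReal_le_of_le_ofReal hc h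
  rw [Measure.integral_comp_mul_left (fun t => |s t|), abs_of_pos (inv_pos.2 ha0), smul_eq_mul,
    inv_mul_le_iff₀ ha0] at h1
  exact h1

lemma enorm_signPot_tilt_le (ha0 : 0 < a) (ha1 : a < 1) (hf : IsProbDensity f) {y m : ℝ}
    (hm : IsMedian (condLaw f y) m) :
    ‖signPot (1 / (2 * a)) (tilt a f) (a * y)‖ₑ
      ≤ ∫⁻ x in Ioo (min (a * y) m) (max (a * y) m),
        ENNReal.ofReal (2 * (tilt a f x * exp (-(1 / (2 * a)) * (x - a * y) ^ 2))) := by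
  rw [enorm_eq_ofReal_abs, ← ofReal_integral_eq_lintegral_ofReal
    ((integrable_tilt_mul_exp ha0 ha1 hf _).const_mul 2).integrableOn
    (Eventually.of_forall fun x => by have := tilt_nonneg (a := a) hf x; positivity)]
  exact ENNReal.ofReal_le_ofReal (abs_signPot_tilt_le ha0 ha1 hf hm)

/-- The weighted integral hypothesis bounds the `L¹` norm of the sign potential. -/
lemma lintegral_signPot_tilt_le_of_weighted {M B ε : ℝ} (ha0 : 0 < a) (ha1 : a < 1)
    (h : NearLinearMedian a M B ε f ψ) (hd : ∀ y, |ψ y - a * y| ≤ √(2 * a * ε)) :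
    ∫⁻ y, ‖signPot (1 / (2 * a)) (tilt a f) (a * y)‖ₑ ≤ ENNReal.ofReal (2 * |M| * max B 0) := by
  have hf := h.density
  have hpt : ∀ y, ‖signPot (1 / (2 * a)) (tilt a f) (a * y)‖ₑ ≤ ENNReal.ofReal (2 * |M|) *
      ENNReal.ofReal (exp ((1 - a) / 2 * y ^ 2 - minExponent a ε y) * |a * y - ψ y|) := fun y => by
    refine (enorm_signPot_tilt_le ha0 ha1 hf (h.median y)).trans ?_
    have hb : ∀ x ∈ Ioo (min (a * y) (ψ y)) (max (a * y) (ψ y)),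
        ENNReal.ofReal (2 * (tilt a f x * exp (-(1 / (2 * a)) * (x - a * y) ^ 2)))
        ≤ ENNReal.ofReal (2 * |M| * exp ((1 - a) / 2 * y ^ 2 - minExponent a ε y)) := fun x hx => by
      refine ENNReal.ofReal_le_ofReal ?_
      have hfx : f x ≤ |M| := (h.bounded x).trans (le_abs_self M)
      have hmin : minExponent a ε y ≤ (x - y) ^ 2 / 2 := by
        refine csInf_le ⟨0, ?_⟩ ⟨x, ?_, rfl⟩
        · rintro _ ⟨z, -, rfl⟩; positivity
        · have h1 := abs_le.1 (hd y)
          have h2 := sqrt_nonneg (2 * a * ε)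
          have h3 : a * y - √(2 * a * ε) ≤ min (a * y) (ψ y) := le_min (by linarith) (by linarith)
          have h4 : max (a * y) (ψ y) ≤ a * y + √(2 * a * ε) := max_le (by linarith) (by linarith)
          exact ⟨h3.trans hx.1.le, hx.2.le.trans h4⟩
      rw [tilt_mul_exp ha0 ha1, mul_assoc]
      refine mul_le_mul_of_nonneg_left ?_ two_pos.le
      have := hf.nonneg x
      gcongr
    refine (setLIntegral_mono' measurableSet_Ioo hb).trans (le_of_eq ?_)
    rw [setLIntegral_const, volume_Ioo, max_sub_min_eq_abs, ← ENNReal.ofReal_mul (by positivity),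
      ← ENNReal.ofReal_mul (by positivity), abs_sub_comm]
    congr 1
    ring
  refine (lintegral_mono hpt).trans ?_
  rw [lintegral_const_mul' _ _ ENNReal.ofReal_ne_top,
    ENNReal.ofReal_mul (p := 2 * |M|) (by positivity)]
  gcongr
  exact h.weighted_integral.trans (ENNReal.ofReal_le_ofReal (le_max_left _ _))

/-- If the local masses of the tilted density are bounded, then the closeness of `ψ⁻¹` to a linear
function makes the sign potential small: for each `x`, the set of `y` with `x` between `a y` and
`ψ y` is contained in an interval of length `2 b ⌊x⌋`. -/
lemma lintegral_signPot_tilt_le_of_inverse {b : ℤ → ℝ} {ε L : ℝ} (ha0 : 0 < a) (ha1 : a < 1)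
    (hf : IsProbDensity f) (hψ : IsCondMedian f ψ) (hb : ∀ x, |genInv ψ x - x / a| ≤ b ⌊x⌋)
    (hs : Summable b) (hε : ∑' i, b i ≤ ε) (hL0 : 0 ≤ L)
    (hL : ∀ i : ℤ, ∫⁻ x in Ico (i : ℝ) (i + 1), ENNReal.ofReal (tilt a f x) ≤ ENNReal.ofReal L) :
    ∫⁻ y, ‖signPot (1 / (2 * a)) (tilt a f) (a * y)‖ₑ ≤ ENNReal.ofReal (4 * L * ε) := by
  have hmono := hψ.monotone hf
  have hbm : Measurable fun x : ℝ => b ⌊x⌋ := (measurable_of_countable b).comp Int.measurable_floor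
  have hgm : Measurable fun x => ENNReal.ofReal (2 * tilt a f x) :=
    ((measurable_tilt hf).const_mul 2).ennreal_ofReal
  set A : Set (ℝ × ℝ) := {p | |p.1 - p.2 / a| ≤ b ⌊p.2⌋} with hA
  have hAm : MeasurableSet A :=
    measurableSet_le (by fun_prop : Measurable fun p : ℝ × ℝ => |p.1 - p.2 / a|)
      (hbm.comp measurable_snd)
  have hpt : ∀ y, ‖signPot (1 / (2 * a)) (tilt a f) (a * y)‖ₑ
      ≤ ∫⁻ x, A.indicator (fun p => ENNReal.ofReal (2 * tilt a f p.2)) (y, x) := fun y => by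
    refine (enorm_signPot_tilt_le ha0 ha1 hf (hψ y)).trans ?_
    rw [← lintegral_indicator measurableSet_Ioo]
    refine lintegral_mono fun x => ?_
    by_cases hx : x ∈ Ioo (min (a * y) (ψ y)) (max (a * y) (ψ y))
    swap
    · rw [indicator_of_notMem hx]
      exact zero_le
    rw [indicator_of_mem hx]
    have hxA : (y, x) ∈ A := abs_sub_div_le ha0 hmono hb hs hε hx
    rw [indicator_of_mem hxA]
    refine ENNReal.ofReal_le_ofReal (mul_le_mul_of_nonneg_left ?_ two_pos.le)
    refine mul_le_of_le_one_right (tilt_nonneg hf x) ?_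
    rw [exp_le_one_iff, neg_mul, neg_nonpos]
    positivity
  have hin : ∀ x, ∫⁻ y, A.indicator (fun p => ENNReal.ofReal (2 * tilt a f p.2)) (y, x)
      = ENNReal.ofReal (2 * tilt a f x) * ENNReal.ofReal (2 * b ⌊x⌋) := fun x => by
    have e : (fun y => A.indicator (fun p => ENNReal.ofReal (2 * tilt a f p.2)) (y, x))
        = (Metric.closedBall (x / a) (b ⌊x⌋)).indicator
          fun _ => ENNReal.ofReal (2 * tilt a f x) := by
      ext y
      simp only [indicator, hA, mem_ofPred_eq, Metric.mem_closedBall, dist_eq]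
    rw [e, lintegral_indicator_const Metric.isClosed_closedBall.measurableSet, volume_closedBall]
  calc ∫⁻ y, ‖signPot (1 / (2 * a)) (tilt a f) (a * y)‖ₑ
      ≤ ∫⁻ y, ∫⁻ x, A.indicator (fun p => ENNReal.ofReal (2 * tilt a f p.2)) (y, x) :=
        lintegral_mono hpt
    _ = ∫⁻ x, ∫⁻ y, A.indicator (fun p => ENNReal.ofReal (2 * tilt a f p.2)) (y, x) :=
        lintegral_lintegral_swap ((hgm.comp measurable_snd).indicator hAm).aemeasurable
    _ = ∫⁻ x, ENNReal.ofReal (2 * tilt a f x) * ENNReal.ofReal (2 * b ⌊x⌋) := by simp_rw [hin]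
    _ = ∑' i : ℤ, ∫⁻ x in Ico (i : ℝ) (i + 1),
          ENNReal.ofReal (2 * tilt a f x) * ENNReal.ofReal (2 * b ⌊x⌋) := by
        rw [← lintegral_iUnion (fun _ => measurableSet_Ico) (pairwise_disjoint_Ico_intCast ℝ),
          iUnion_Ico_intCast, Measure.restrict_univ]
    _ ≤ ∑' i : ℤ, ENNReal.ofReal (4 * L * b i) := by
        refine ENNReal.tsum_le_tsum fun i => ?_
        have hbi := nonneg_of_inverse_close hb i
        have e : ∫⁻ x in Ico (i : ℝ) (i + 1),
            ENNReal.ofReal (2 * tilt a f x) * ENNReal.ofReal (2 * b ⌊x⌋)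
            = ∫⁻ x in Ico (i : ℝ) (i + 1),
              ENNReal.ofReal (4 * b i) * ENNReal.ofReal (tilt a f x) := by
          refine setLIntegral_congr_fun measurableSet_Ico fun x hx => ?_
          have hxi : ⌊x⌋ = i := Int.floor_eq_iff.2 hx
          have := tilt_nonneg (a := a) hf x
          simp only [hxi]
          rw [← ENNReal.ofReal_mul (by positivity), ← ENNReal.ofReal_mul (by positivity)]
          congr 1
          ring
        rw [e, lintegral_const_mul' _ _ ENNReal.ofReal_ne_top,
          show 4 * L * b i = 4 * b i * L by ring,
          ENNReal.ofReal_mul (p := 4 * b i) (q := L) (by positivity)]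
        gcongr
        exact hL i
    _ = ENNReal.ofReal (∑' i : ℤ, 4 * L * b i) :=
        (ENNReal.ofReal_tsum_of_nonneg (fun i => by
          have := nonneg_of_inverse_close hb i; positivity) (hs.mul_left _)).symm
    _ ≤ ENNReal.ofReal (4 * L * ε) := by
        refine ENNReal.ofReal_le_ofReal ?_
        rw [tsum_mul_left]
        gcongr

/-- The sign potential of the tilted density has `L¹` norm `O(ε)`. The weighted integral hypothesis
first gives a bound `O(1)`, hence a bound for the local masses of the tilted density. -/
lemma exists_integral_abs_signPot_le (a M B : ℝ) (ha0 : 0 < a) (ha1 : a < 1) :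
    ∃ C : ℝ, 0 ≤ C ∧ ∀ (ε : ℝ) (f ψ : ℝ → ℝ), 0 ≤ ε → ε ≤ 2 / a →
      NearLinearMedian a M B ε f ψ → Integrable (signPot (1 / (2 * a)) (tilt a f)) ∧
        ∫ t, |signPot (1 / (2 * a)) (tilt a f) t| ≤ C * ε := by
  have hα : 0 < 1 / (2 * a) := by positivity
  have hT := gaussTail_pos hα 1
  set L := (√(π / (1 / (2 * a))) / 2 + a * (2 * |M| * max B 0)) / gaussTail (1 / (2 * a)) 1 with hL
  have hB : 0 ≤ max B 0 := le_max_right _ _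
  have hL0 : 0 ≤ L := by positivity
  refine ⟨a * (4 * L), by positivity, fun ε f ψ hε0 hε h => ?_⟩
  have hf := h.density
  have hg := gaussAdmissible_tilt ha0 ha1 hf
  obtain ⟨b, hs, hbε, hb⟩ := h.inverse_close
  have hd : ∀ y, |ψ y - a * y| ≤ √(2 * a * ε) := fun y => by
    -- For `ε ≤ 2 / a` the bound `a ε` is at most the radius `√(2 a ε)` in `minExponent`.
    refine (abs_median_sub_le ha0 (h.median.monotone hf) hb hs hbε y).trans (le_sqrt_of_sq_le ?_)
    rw [le_div_iff₀ ha0] at hε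
    have : 0 ≤ a * ε := by positivity
    nlinarith
  obtain ⟨hFi, hF⟩ := integrable_and_integral_abs_le_of_comp_mul ha0 (measurable_signPot hg)
    (by positivity) (lintegral_signPot_tilt_le_of_weighted ha0 ha1 h hd)
  have hmass : ∀ i : ℤ, ∫⁻ x in Ico (i : ℝ) (i + 1), ENNReal.ofReal (tilt a f x)
      ≤ ENNReal.ofReal L := fun i => by
    refine (lintegral_Ico_le hα hg i).trans (ENNReal.ofReal_le_ofReal ?_)
    have h1 := tailPot_le hα hg hFi i
    have h2 := tailPot_tilt_zero_le ha0 ha1 hf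
    rw [hL]
    gcongr
    linarith
  have h3 := (integrable_and_integral_abs_le_of_comp_mul ha0 (measurable_signPot hg)
    (by positivity) (lintegral_signPot_tilt_le_of_inverse ha0 ha1 hf h.median hb hs hbε hL0
      hmass)).2
  exact ⟨hFi, h3.trans (le_of_eq (by ring))⟩

/-! ### Hermite coefficients and the conclusion -/

lemma mul_hermiteFun_eq (f : ℝ → ℝ) (n : ℕ) (x : ℝ) :
    f x * hermiteFun a n x = (hermiteNorm a n)⁻¹ *
      (tilt a f x * iteratedDeriv n (fun x : ℝ => exp (-(1 / sigma a ^ 2) * x ^ 2)) x) := by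
  have h2 : exp (-(1 / (2 * sigma a ^ 2)) * x ^ 2)
      = exp (1 / (2 * sigma a ^ 2) * x ^ 2) * exp (-(1 / sigma a ^ 2) * x ^ 2) := by
    rw [← exp_add]; congr 1; ring
  rw [hermiteFun_eq, iteratedDeriv_gaussian, tilt, h2]
  ring

/-- All Hermite coefficients but the zeroth are controlled by the sign potential. -/
lemma exists_abs_hermiteCoeff_le (a : ℝ) (ha0 : 0 < a) (ha1 : a < 1) :
    ∃ C : ℝ, 0 ≤ C ∧ ∀ f : ℝ → ℝ, IsProbDensity f →
      Integrable (signPot (1 / (2 * a)) (tilt a f)) → ∀ n : ℕ, n ≠ 0 →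
        |hermiteCoeff a f n|
          ≤ C * (n : ℝ) ^ (1 / 4 : ℝ) * ∫ t, |signPot (1 / (2 * a)) (tilt a f) t| := by
  have hα : 0 < 1 / (2 * a) := by positivity
  have hσ := sigma_pos ha0 ha1
  obtain ⟨C, hC0, hC⟩ := exists_integral_le_hermiteNorm hα ha0 ha1
  refine ⟨C, hC0, fun f hf hF n hn => ?_⟩
  obtain ⟨m, rfl⟩ := Nat.exists_eq_succ_of_ne_zero hn
  have hK := hermiteNorm_pos ha0 ha1 (m + 1)
  have h1 := abs_integral_iteratedDeriv_gaussian_le hα (β := 1 / sigma a ^ 2) (by positivity)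
    (gaussAdmissible_tilt ha0 ha1 hf) hF m
  rw [hermiteCoeff]
  simp_rw [mul_hermiteFun_eq]
  rw [integral_const_mul, abs_mul, abs_of_pos (inv_pos.2 hK), inv_mul_le_iff₀ hK]
  refine h1.trans ?_
  refine (mul_le_mul_of_nonneg_left (hC m) (integral_nonneg fun _ => abs_nonneg _)).trans
    (le_of_eq ?_)
  simp only [Nat.succ_eq_add_one]
  ring

lemma eLpNorm_two_sq {v : ℝ → ℝ} (hv : MemLp v 2) :
    eLpNorm v 2 volume ^ 2 = ENNReal.ofReal (∫ x, v x ^ 2) := by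
  have h := eLpNorm_nnreal_pow_eq_lintegral (f := v) (μ := volume) (p := 2) two_ne_zero
  have hi := (memLp_two_iff_integrable_sq hv.aestronglyMeasurable).1 hv
  rw [ofReal_integral_eq_lintegral_ofReal hi (Eventually.of_forall fun x => sq_nonneg _)]
  simp only [NNReal.coe_ofNat, ENNReal.coe_ofNat, ENNReal.rpow_ofNat] at h
  rw [h]
  congr 1 with x
  rw [enorm_eq_ofReal_abs, ← ENNReal.ofReal_pow (abs_nonneg _), sq_abs]

lemma memLp_sub_hermite (ha0 : 0 < a) (ha1 : a < 1) (hf : MemLp f 2) :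
    MemLp (fun x => f x - hermiteCoeff a f 0 * hermiteFun a 0 x) 2 :=
  hf.sub ((memLp_hermiteFun ha0 ha1 0).const_mul _)

lemma hasSum_sub_hermite_sq (ha0 : 0 < a) (ha1 : a < 1) (hf : MemLp f 2) :
    HasSum (fun n => if n = 0 then 0 else hermiteCoeff a f n ^ 2)
      (∫ x, (f x - hermiteCoeff a f 0 * hermiteFun a 0 x) ^ 2) := by
  have h := hasSum_hermiteCoeff_sq ha0 ha1 (memLp_sub_hermite ha0 ha1 hf)
  refine h.congr_fun fun n => ?_
  rw [hermiteCoeff_sub ha0 ha1 hf]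
  split_ifs <;> simp

/-- The distance of `f` to its projection on the zeroth Hermite function. -/
lemma exists_integral_sub_hermite_sq_le (a M B S : ℝ) (ha0 : 0 < a) (ha1 : a < 1) :
    ∃ C : ℝ, 0 ≤ C ∧ ∀ (ε : ℝ) (f ψ : ℝ → ℝ), 0 ≤ ε → NearLinearMedian a M B ε f ψ →
      MemLp f 2 →
      Summable (fun n : ℕ => |hermiteCoeff a f n| * (n : ℝ) ^ (1 / 4 : ℝ)) →
      ∑' n : ℕ, |hermiteCoeff a f n| * (n : ℝ) ^ (1 / 4 : ℝ) ≤ S →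
      ∫ x, (f x - hermiteCoeff a f 0 * hermiteFun a 0 x) ^ 2 ≤ C * ε := by
  obtain ⟨C₁, hC₁0, hC₁⟩ := exists_integral_abs_signPot_le a M B ha0 ha1
  obtain ⟨C₂, hC₂0, hC₂⟩ := exists_abs_hermiteCoeff_le a ha0 ha1
  refine ⟨C₂ * C₁ * |S| + |M| * a, by positivity, fun ε f ψ hε0 h hf2 hsum hS => ?_⟩
  have hf := h.density
  have hP := hasSum_sub_hermite_sq ha0 ha1 hf2
  rcases le_total ε (2 / a) with hε | hε
  · obtain ⟨hFi, hF⟩ := hC₁ ε f ψ hε0 hε h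
    set I := ∫ t, |signPot (1 / (2 * a)) (tilt a f) t| with hI
    have hI0 : 0 ≤ I := integral_nonneg fun _ => abs_nonneg _
    have hle := hasSum_le (fun n => ?_) hP (hsum.hasSum.mul_left (C₂ * I))
    · calc _ ≤ _ := hle
        _ ≤ C₂ * (C₁ * ε) * |S| := by
            gcongr
            exact hS.trans (le_abs_self S)
        _ ≤ (C₂ * C₁ * |S| + |M| * a) * ε := by
            have : 0 ≤ |M| * a * ε := by positivity
            linarith
    · split_ifs with hn
      · positivity
      · rw [← sq_abs, pow_two]
        calc |hermiteCoeff a f n| * |hermiteCoeff a f n|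
            ≤ |hermiteCoeff a f n| * (C₂ * (n : ℝ) ^ (1 / 4 : ℝ) * I) :=
              mul_le_mul_of_nonneg_left (hC₂ f hf hFi n hn) (abs_nonneg _)
          _ = _ := by ring
  -- For large `ε` the trivial bound `‖f‖₂² ≤ M` suffices.
  · have hle := hasSum_le (fun n => ?_) hP (hasSum_hermiteCoeff_sq ha0 ha1 hf2)
    · have h1 : ∫ x, f x ^ 2 ≤ |M| := by
        calc ∫ x, f x ^ 2 ≤ ∫ x, |M| * f x := by
              refine integral_mono
                ((memLp_two_iff_integrable_sq hf2.aestronglyMeasurable).1 hf2)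
                (hf.integrable.const_mul _) fun x => ?_
              simp only [pow_two]
              exact mul_le_mul_of_nonneg_right ((h.bounded x).trans (le_abs_self M)) (hf.nonneg x)
          _ = |M| := by rw [integral_const_mul, integral_eq_one_of_isProbDensity hf, mul_one]
      have h2 : |M| ≤ |M| * (a * ε) := by
        rw [div_le_iff₀ ha0] at hε
        refine le_mul_of_one_le_right (abs_nonneg _) (by linarith)
      have h3 : 0 ≤ C₂ * C₁ * |S| * ε := by positivity
      calc _ ≤ _ := hle
        _ ≤ _ := by linarith
    · split_ifs
      · positivity
      · exact le_rfl

/-- Both the zeroth Hermite function and the density of `N(0, σ²)` are multiples of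
`exp (-x² / (2σ²))`. -/
lemma hermiteFun_zero_sub_gaussianPDFReal (ha0 : 0 < a) (ha1 : a < 1) (c x : ℝ) :
    c * hermiteFun a 0 x - gaussianPDFReal 0 (a / (1 - a)).toNNReal x
      = (√2 * (hermiteNorm a 0 * c) - 1) *
        ((√2 * √π * sigma a)⁻¹ * exp (-(1 / (2 * sigma a ^ 2)) * x ^ 2)) := by
  have hσ := sigma_pos ha0 ha1
  have hK := hermiteNorm_pos ha0 ha1 0
  have hK2 : hermiteNorm a 0 ^ 2 = √π * sigma a := by
    rw [hermiteNorm_sq ha0 ha1]; simp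
  have hv : (((a / (1 - a)).toNNReal : NNReal) : ℝ) = sigma a ^ 2 := by
    rw [sigma_sq ha0 ha1, coe_toNNReal _ (div_pos ha0 (sub_pos.2 ha1)).le]
  have hs : √(2 * π * sigma a ^ 2) = √2 * √π * sigma a := by
    rw [sqrt_mul (by positivity), sqrt_mul two_pos.le, sqrt_sq hσ.le]
  have he : -(x - 0) ^ 2 / (2 * sigma a ^ 2) = -(1 / (2 * sigma a ^ 2)) * x ^ 2 := by ring
  have hKi : (hermiteNorm a 0)⁻¹ = hermiteNorm a 0 * (√π * sigma a)⁻¹ := by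
    rw [← hK2]; field_simp
  rw [hermiteFun_eq, gaussianPDFReal_def, hv, hs]
  simp only [gaussPoly, Polynomial.eval_one, one_mul, he, hKi]
  have h2 : 0 < √2 := by positivity
  have hπ : 0 < √π := by positivity
  field_simp

/-- The zeroth Hermite coefficient is close to that of the Gaussian density: both it and the total
mass `1` of `f` are Gaussian averages of the tilted density. -/
lemma exists_abs_hermiteCoeff_zero_sub_le (a : ℝ) (ha0 : 0 < a) (ha1 : a < 1) :
    ∃ C : ℝ, 0 ≤ C ∧ ∀ f : ℝ → ℝ, IsProbDensity f →
      Integrable (signPot (1 / (2 * a)) (tilt a f)) →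
        |√2 * (hermiteNorm a 0 * hermiteCoeff a f 0) - 1|
          ≤ C * ∫ t, |signPot (1 / (2 * a)) (tilt a f) t| := by
  have hα : 0 < 1 / (2 * a) := by positivity
  have hσ := sigma_pos ha0 ha1
  obtain ⟨D₁, hD₁0, hD₁⟩ := exists_abs_integral_gaussian_sub_le hα
    (β := 1 / (2 * sigma a ^ 2)) (by positivity)
  obtain ⟨D₂, hD₂0, hD₂⟩ := exists_abs_integral_gaussian_sub_le hα
    (β := 1 / sigma a ^ 2) (by positivity)
  refine ⟨√2 * D₂ + D₁, by positivity, fun f hf hF => ?_⟩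
  have hg := gaussAdmissible_tilt ha0 ha1 hf
  have h1 := hD₁ _ hg hF
  have h2 := hD₂ _ hg hF
  have e1 : ∫ x, tilt a f x * exp (-(1 / (2 * sigma a ^ 2)) * x ^ 2) = 1 := by
    refine Eq.trans ?_ (integral_eq_one_of_isProbDensity hf)
    congr 1 with x
    rw [tilt, mul_assoc, ← exp_add]
    simp
  have e2 : ∫ x, tilt a f x * exp (-(1 / sigma a ^ 2) * x ^ 2)
      = hermiteNorm a 0 * hermiteCoeff a f 0 := by
    have hK := hermiteNorm_pos ha0 ha1 0
    rw [hermiteCoeff]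
    simp_rw [mul_hermiteFun_eq, iteratedDeriv_zero]
    rw [integral_const_mul, mul_inv_cancel_left₀ hK.ne']
  have e3 : √(π / (1 / (2 * sigma a ^ 2))) = √2 * √(π / (1 / sigma a ^ 2)) := by
    rw [← sqrt_mul two_pos.le]
    congr 1
    field_simp
  rw [e1, e3] at h1
  rw [e2] at h2
  set I := ∫ t, |signPot (1 / (2 * a)) (tilt a f) t|
  set K := tailPotBot (1 / (2 * a)) (tilt a f) * (tailHat (1 / (2 * a)) 0)⁻¹
  set r := √(π / (1 / sigma a ^ 2))
  set z := hermiteNorm a 0 * hermiteCoeff a f 0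
  calc |√2 * z - 1| = |√2 * (z - K * r) - (1 - K * (√2 * r))| := by congr 1; ring
    _ ≤ |√2 * (z - K * r)| + |1 - K * (√2 * r)| := abs_sub _ _
    _ ≤ √2 * (D₂ * I) + D₁ * I := by
        rw [abs_mul, abs_of_nonneg (sqrt_nonneg 2)]
        gcongr
    _ = _ := by ring

end L1Stability

theorem mainTheorem3 (a M B S : ℝ) (ha0 : 0 < a) (ha1 : a < 1) :
    (∃ C : ℝ, 0 ≤ C ∧ ∀ (ε : ℝ) (f ψ : ℝ → ℝ), 0 ≤ ε →
      L1Stability.NearLinearMedian a M B ε f ψ →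
      MemLp f 2 volume →
      Summable (fun n : ℕ => |L1Stability.hermiteCoeff a f n| * (n : ℝ) ^ (1 / 4 : ℝ)) →
      ∑' n : ℕ, |L1Stability.hermiteCoeff a f n| * (n : ℝ) ^ (1 / 4 : ℝ) ≤ S →
      eLpNorm (fun x => f x - L1Stability.hermiteCoeff a f 0 * L1Stability.hermiteFun a 0 x)
        2 volume ^ 2 ≤ ENNReal.ofReal (C * ε)) ∧
    (∀ δ : ℝ, 0 < δ → ∃ ε₀ : ℝ, 0 < ε₀ ∧ ∀ (ε : ℝ) (f ψ : ℝ → ℝ), 0 ≤ ε → ε ≤ ε₀ →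
      L1Stability.NearLinearMedian a M B ε f ψ →
      MemLp f 2 volume →
      Summable (fun n : ℕ => |L1Stability.hermiteCoeff a f n| * (n : ℝ) ^ (1 / 4 : ℝ)) →
      ∑' n : ℕ, |L1Stability.hermiteCoeff a f n| * (n : ℝ) ^ (1 / 4 : ℝ) ≤ S →
      eLpNorm (fun x => f x - gaussianPDFReal 0 (a / (1 - a)).toNNReal x) 2 volume
        ≤ ENNReal.ofReal δ) := by
  obtain ⟨C, hC0, hC⟩ := L1Stability.exists_integral_sub_hermite_sq_le a M B S ha0 ha1
  have hpart : ∀ (ε : ℝ) (f ψ : ℝ → ℝ), 0 ≤ ε →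
      L1Stability.NearLinearMedian a M B ε f ψ → MemLp f 2 volume →
      Summable (fun n : ℕ => |L1Stability.hermiteCoeff a f n| * (n : ℝ) ^ (1 / 4 : ℝ)) →
      ∑' n : ℕ, |L1Stability.hermiteCoeff a f n| * (n : ℝ) ^ (1 / 4 : ℝ) ≤ S →
      eLpNorm (fun x => f x - L1Stability.hermiteCoeff a f 0 * L1Stability.hermiteFun a 0 x)
        2 volume ^ 2 ≤ ENNReal.ofReal (C * ε) := fun ε f ψ hε h hf2 hsum hS => by
    rw [L1Stability.eLpNorm_two_sq (L1Stability.memLp_sub_hermite ha0 ha1 hf2)]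
    exact ENNReal.ofReal_le_ofReal (hC ε f ψ hε h hf2 hsum hS)
  refine ⟨⟨C, hC0, hpart⟩, fun δ hδ => ?_⟩
  obtain ⟨C₁, hC₁0, hC₁⟩ := L1Stability.exists_integral_abs_signPot_le a M B ha0 ha1
  obtain ⟨C₂, hC₂0, hC₂⟩ := L1Stability.exists_abs_hermiteCoeff_zero_sub_le a ha0 ha1
  have hσ := L1Stability.sigma_pos ha0 ha1
  set G : ℝ → ℝ := fun x => (√2 * √Real.pi * L1Stability.sigma a)⁻¹ *
    Real.exp (-(1 / (2 * L1Stability.sigma a ^ 2)) * x ^ 2) with hG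
  have hGm : MemLp G 2 volume := by
    have h := L1Stability.memLp_eval_mul_gaussian (β := 1 / (2 * L1Stability.sigma a ^ 2))
      (by positivity) 1
    simp only [Polynomial.eval_one, one_mul] at h
    exact h.const_mul _
  set N := (eLpNorm G 2 volume).toReal with hN
  have hN0 : 0 ≤ N := ENNReal.toReal_nonneg
  -- The three bounds are for the `L¹` bound on the sign potential, for the distance of `f` to
  -- `c₀ H₀`, and for the distance of `c₀ H₀` to the Gaussian density.
  refine ⟨min (2 / a) (min ((δ / 2) ^ 2 / (C + 1)) (δ / 2 / (C₂ * C₁ * N + 1))), by positivity,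
    fun ε f ψ hε hεle h hf2 hsum hS => ?_⟩
  have hε1 := hεle.trans (min_le_left _ _)
  have hε2 := hεle.trans ((min_le_right _ _).trans (min_le_left _ _))
  have hε3 := hεle.trans ((min_le_right _ _).trans (min_le_right _ _))
  rw [le_div_iff₀ (by positivity)] at hε2 hε3
  obtain ⟨hFi, hF⟩ := hC₁ ε f ψ hε hε1 h
  have hfirst : eLpNorm
      (fun x => f x - L1Stability.hermiteCoeff a f 0 * L1Stability.hermiteFun a 0 x) 2 volume
      ≤ ENNReal.ofReal (δ / 2) := by
    have h1 := hpart ε f ψ hε h hf2 hsum hS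
    have h2 : ENNReal.ofReal (C * ε) ≤ ENNReal.ofReal (δ / 2) ^ 2 := by
      rw [← ENNReal.ofReal_pow (by positivity)]
      exact ENNReal.ofReal_le_ofReal (by linarith)
    exact (ENNReal.pow_le_pow_left_iff two_ne_zero).1 (h1.trans h2)
  have hsecond : eLpNorm (fun x => L1Stability.hermiteCoeff a f 0 * L1Stability.hermiteFun a 0 x
      - gaussianPDFReal 0 (a / (1 - a)).toNNReal x) 2 volume ≤ ENNReal.ofReal (δ / 2) := by
    simp_rw [L1Stability.hermiteFun_zero_sub_gaussianPDFReal ha0 ha1]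
    set t := √2 * (L1Stability.hermiteNorm a 0 * L1Stability.hermiteCoeff a f 0) - 1 with ht
    have h1 : |t| ≤ C₂ * (C₁ * ε) :=
      (hC₂ f h.density hFi).trans (mul_le_mul_of_nonneg_left hF hC₂0)
    have h2 : eLpNorm (fun x => t * G x) 2 volume = ‖t‖ₑ * eLpNorm G 2 volume :=
      eLpNorm_const_smul t G 2 volume
    rw [h2, ← ENNReal.ofReal_toReal hGm.eLpNorm_ne_top, ← hN, Real.enorm_eq_ofReal_abs,
      ← ENNReal.ofReal_mul (abs_nonneg t)]
    refine ENNReal.ofReal_le_ofReal ((mul_le_mul_of_nonneg_right h1 hN0).trans ?_)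
    linarith
  have hsplit : (fun x => f x - gaussianPDFReal 0 (a / (1 - a)).toNNReal x)
      = (fun x => f x - L1Stability.hermiteCoeff a f 0 * L1Stability.hermiteFun a 0 x)
        + fun x => L1Stability.hermiteCoeff a f 0 * L1Stability.hermiteFun a 0 x
          - gaussianPDFReal 0 (a / (1 - a)).toNNReal x := by
    ext x
    simp
  have hm := (L1Stability.memLp_hermiteFun ha0 ha1 0).aestronglyMeasurable
  rw [hsplit]
  refine (eLpNorm_add_le ?_ ?_ one_le_two).trans ((add_le_add hfirst hsecond).trans ?_)
  · exact hf2.aestronglyMeasurable.sub (hm.const_mul _)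
  · exact (hm.const_mul _).sub (measurable_gaussianPDFReal _ _).aestronglyMeasurable
  · rw [← ENNReal.ofReal_add (by positivity) (by positivity), add_halves]

end
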